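/- Let $R$ be a two-sided noetherian ring; all modules are finitely generated, $R$-modules are right modules, and $R^{\mathrm{op}}$-modules are left $R$-modules. Write $(-)^*=\operatorname{Hom}(-,R)$ for the $R$-dual (on either side), and use the following notions. *Grade.* The grade of a module $N$ is $\operatorname{grade} N=\inf\{\,i\ge 0 : \operatorname{Ext}^i(N,R)\neq 0\,\}\in\mathbb{N}\cup\{\infty\}$. *Syzygies and transposes.* For a module $X$ with a resolution $\cdots\to P_2\xrightarrow{\partial_2}P_1\xrightarrow{\partial_1}P_0\xrightarrow{\partial_0} X\to 0$ by finitely generated projective modules, put $\Omega^iX=\operatorname{Im}\partial_i$ and $\operatorname{Tr}X=\operatorname{Cok}(\partial_1^*\colon P_0^*\to P_1^*)$, a module over the opposite side; both are unique up to projective summands. A homomorphism $f\colon X\to Y$ lifts to projective resolutions and so induces $\operatorname{Tr}f\colon \operatorname{Tr}Y\to\operatorname{Tr}X$. From the resolution of $X$ one gets $\operatorname{Tr}\Omega^iX=\operatorname{Cok}(P_i^*\to P_{i+1}^*)$. *Torsionfreeness.* $X$ is $i$-torsionfree if $\operatorname{Ext}^k_{R^{\mathrm{op}}}(\operatorname{Tr}X,R)=0$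 for all $1\le k\le i$. *Condition $(\mathrm{T}_j)$.* A homomorphism $f\colon X\to Y$ of $R$-modules satisfies $(\mathrm{T}_j)$, $j\ge1$, if $\operatorname{Ext}^k_{R^{\mathrm{op}}}(\operatorname{Tr}f,R)\colon\operatorname{Ext}^k_{R^{\mathrm{op}}}(\operatorname{Tr}X,R)\to\operatorname{Ext}^k_{R^{\mathrm{op}}}(\operatorname{Tr}Y,R)$ is bijective for $1\le k\le j-1$ and injective for $k=j$; every homomorphism satisfies $(\mathrm{T}_0)$. *The natural maps.* Let $M$ be an $R$-module with a resolution $P_\bullet\to M$ by finitely generated projective modules. For each $i\ge0$ let $Q^i_\bullet\to\operatorname{Tr}\Omega^iM=\operatorname{Cok}(P_i^*\to P_{i+1}^*)$ be a resolution by finitely generated projective left modules, and put $\mathrm{J}^2_iM=\operatorname{Tr}\Omega^i\operatorname{Tr}\Omega^iM=\operatorname{Cok}\big((Q^i_i)^*\to(Q^i_{i+1})^*\big)$. - Choose a chain map from $P_0^*\to P_1^*\to\cdots\to P_{i+1}^*\to\operatorname{Tr}\Omega^iM$ to $Q^i_{i+1}\to Q^i_i\to\cdots\to Q^i_0\to\operatorname{Tr}\Omega^iM$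 over the identity of $\operatorname{Tr}\Omega^iM$. The duals of its components $P_1^*\to Q^i_i$ and $P_0^*\to Q^i_{i+1}$, together with $P_k^{**}\cong P_k$, induce on cokernels the map $\psi^i_M\colon\mathrm{J}^2_iM\to M$. - For $i\ge1$ choose a chain map from $\cdots\to Q^{i-1}_1\to Q^{i-1}_0\to P_{i+1}^*\to\operatorname{Tr}\Omega^iM$ to $\cdots\to Q^i_2\to Q^i_1\to Q^i_0\to\operatorname{Tr}\Omega^iM$ over the identity of $\operatorname{Tr}\Omega^iM$, where $Q^{i-1}_0\to P_{i+1}^*$ is the composite of $Q^{i-1}_0\to\operatorname{Tr}\Omega^{i-1}M=\operatorname{Cok}(P_{i-1}^*\to P_i^*)$ and the map induced by $P_i^*\to P_{i+1}^*$. The duals of its components $Q^{i-1}_{i-1}\to Q^i_i$ and $Q^{i-1}_i\to Q^i_{i+1}$ induce on cokernels the map $\psi^{i,i-1}_M\colon\mathrm{J}^2_iM\to\mathrm{J}^2_{i-1}M$. **Theorem.** Let $n\ge1$ and $j\ge0$ be integers and $M$ a finitely generated right $R$-module. For every choice of the resolutions and chain maps above, the following are equivalent. 1. $\operatorname{grade}_{R^{\mathrm{op}}}\operatorname{Ext}^i_R(M,R)\ge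 i+j-1$ for all $1\le i\le n$. 2. For all $1\le i\le n$, the syzygy $\Omega^iM$ is $i$-torsionfree and the map $\psi^i_M\colon\mathrm{J}^2_iM\to M$ satisfies $(\mathrm{T}_j)$. 3. For all $1\le i\le n$, the syzygy $\Omega^iM$ is $i$-torsionfree and the map $\psi^{i,i-1}_M\colon\mathrm{J}^2_iM\to\mathrm{J}^2_{i-1}M$ satisfies $(\mathrm{T}_j)$. -/

import Mathlib

/-!
Conventions.  A right `R`-module is a module over `Rᵐᵒᵖ`, a left `R`-module is a module over `R`.
Since transposition exchanges the two sides, the notions below are set up for two rings `A`, `B` and an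
abelian group `D` with commuting actions of `A` and `B`; they are only used for
`(A, B, D) = (Rᵐᵒᵖ, R, R)` and `(A, B, D) = (R, Rᵐᵒᵖ, R)`, where `Hom_A(-, D)` is the `R`-dual.
-/

open CategoryTheory

universe u

noncomputable section

namespace StableModule

/-- A projective resolution `⋯ ⟶ P 2 ⟶ P 1 ⟶ P 0 ⟶ X ⟶ 0` by finitely generated projective modules. -/
structure FGResolution {A : Type u} [Ring A] (X : ModuleCat.{u} A) extends
    ProjectiveResolution X where
  finite : ∀ i, Module.Finite A (complex.X i)

namespace FGResolution

variable {A : Type u} [Ring A] {X : ModuleCat.{u} A}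

/-- The `i`-th module of the resolution. -/
abbrev obj (P : FGResolution X) (i : ℕ) : ModuleCat.{u} A := P.complex.X i

/-- The differential `P (i + 1) ⟶ P i`. -/
abbrev diff (P : FGResolution X) (i : ℕ) : P.obj (i + 1) ⟶ P.obj i := P.complex.d (i + 1) i

/-- The augmentation `P 0 ⟶ X`. -/
def aug (P : FGResolution X) : P.obj 0 ⟶ X := P.π.f 0

theorem diff_aug (P : FGResolution X) : P.diff 0 ≫ P.aug = 0 :=
  P.toProjectiveResolution.complex_d_comp_π_f_zero

theorem diff_diff (P : FGResolution X) (i : ℕ) : P.diff (i + 1) ≫ P.diff i = 0 :=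
  P.complex.d_comp_d _ _ _

/-- The `n`-th syzygy of `X` computed from `P`: the image of `P n ⟶ P (n - 1)`, and `X` for `n = 0`. -/
def syzygy (P : FGResolution X) : ℕ → ModuleCat.{u} A
  | 0 => X
  | n + 1 => ModuleCat.of A (LinearMap.range (P.diff n).hom)

end FGResolution

section Dual

variable (A B D : Type u) [Ring A] [Ring B] [AddCommGroup D] [Module A D] [Module B D]
  [SMulCommClass A B D]

/-- The `B`-module `X^* = Hom_A(X, D)`, with `(b • φ) x = b • φ x`. -/
abbrev dual (X : ModuleCat.{u} A) : ModuleCat.{u} B := ModuleCat.of B (X →ₗ[A] D)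

variable {A} in
/-- The map `f^* : Y^* ⟶ X^*`, `φ ↦ φ ∘ f`. -/
def dualMap {X Y : ModuleCat.{u} A} (f : X ⟶ Y) : dual A B D Y ⟶ dual A B D X :=
  ModuleCat.ofHom (LinearMap.lcomp B D f.hom)

theorem dualMap_comp {X Y Z : ModuleCat.{u} A} (f : X ⟶ Y) (g : Y ⟶ Z) :
    dualMap B D (f ≫ g) = dualMap B D g ≫ dualMap B D f := rfl

theorem dualMap_zero {X Y : ModuleCat.{u} A} : dualMap B D (0 : X ⟶ Y) = 0 := by
  ext φ x
  exact map_zero (φ : Y →ₗ[A] D)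

variable {A} {X Y : ModuleCat.{u} A}

/-- The transpose `Tr Ω^n X = Cok (P n ^* ⟶ P (n + 1) ^*)` of the `n`-th syzygy of `X`, computed from
the presentation `P (n + 1) ⟶ P n ⟶ Ω^n X ⟶ 0` that is part of the resolution `P`. -/
def trSyzygy (P : FGResolution X) (n : ℕ) : ModuleCat.{u} B :=
  Limits.cokernel (dualMap B D (P.diff n))

/-- The transpose `Tr X = Cok (P 0 ^* ⟶ P 1 ^*)`. -/
abbrev transpose (P : FGResolution X) : ModuleCat.{u} B := trSyzygy B D P 0

/-- The map `Tr f : Tr Y ⟶ Tr X` induced by a lift of `f` to the resolutions. -/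
def transposeMap (P : FGResolution X) (Q : FGResolution Y) (f : X ⟶ Y) :
    transpose B D Q ⟶ transpose B D P :=
  Limits.cokernel.map (dualMap B D (Q.diff 0)) (dualMap B D (P.diff 0))
    (dualMap B D
      ((ProjectiveResolution.lift f P.toProjectiveResolution Q.toProjectiveResolution).f 0))
    (dualMap B D
      ((ProjectiveResolution.lift f P.toProjectiveResolution Q.toProjectiveResolution).f 1))
    (by
      rw [← dualMap_comp, ← dualMap_comp]
      exact congrArg (dualMap B D) (HomologicalComplex.Hom.comm _ 1 0))

/-- `X` is `n`-torsionfree: `Ext_B^i(Tr X, D) = 0` for `1 ≤ i ≤ n`. -/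
def IsTorsionfree (n : ℕ) (X : ModuleCat.{u} A) : Prop :=
  ∀ (P : FGResolution X) (i : ℕ), 1 ≤ i → i ≤ n →
    Subsingleton (Abelian.Ext (transpose B D P) (ModuleCat.of B D) i)

/-- The map `Ext_B^i(h, D) : Ext_B^i(Y, D) → Ext_B^i(X, D)` for `h : X ⟶ Y`. -/
def extMap {X Y : ModuleCat.{u} B} (h : X ⟶ Y) (i : ℕ) :
    Abelian.Ext Y (ModuleCat.of B D) i → Abelian.Ext X (ModuleCat.of B D) i :=
  fun e => (Abelian.Ext.mk₀ h).comp e (zero_add i)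

/-- The condition `(T_n)` for `f : X ⟶ Y`: the map `Ext_B^i(Tr f, D)` is bijective for
`1 ≤ i ≤ n - 1` and injective for `i = n`; it is empty for `n = 0`. -/
def ConditionT (n : ℕ) (f : X ⟶ Y) : Prop :=
  ∀ (P : FGResolution X) (Q : FGResolution Y) (i : ℕ), 1 ≤ i →
    (i < n → Function.Bijective (extMap B D (transposeMap B D P Q f) i)) ∧
    (i = n → Function.Injective (extMap B D (transposeMap B D P Q f) i))

/-- Multiplication by `b` on `D`, as an endomorphism of the `A`-module `D`. -/
def mulEnd (b : B) : ModuleCat.of A D ⟶ ModuleCat.of A D :=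
  ModuleCat.ofHom
    { toFun := fun d => b • d
      map_add' := smul_add b
      map_smul' := fun a d => (smul_comm a b d).symm }

/-- The `B`-module structure on `Ext_A^i(X, D)` induced by the action of `B` on `D`. -/
abbrev extModule (X : ModuleCat.{u} A) (i : ℕ) :
    Module B (Abelian.Ext X (ModuleCat.of A D) i) where
  smul b e := e.comp (Abelian.Ext.mk₀ (mulEnd B D b)) (add_zero i)
  one_smul e := by
    have h : mulEnd (A := A) B D 1 = 𝟙 _ := by
      ext d
      exact one_smul B (d : D)
    change e.comp (Abelian.Ext.mk₀ (mulEnd B D 1)) (add_zero i) = e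
    rw [h, Abelian.Ext.comp_mk₀_id]
  mul_smul b c e := by
    have h : mulEnd (A := A) B D (b * c) = mulEnd B D c ≫ mulEnd B D b := by
      ext d
      exact mul_smul b c (d : D)
    change e.comp (Abelian.Ext.mk₀ (mulEnd B D (b * c))) (add_zero i) =
      (e.comp (Abelian.Ext.mk₀ (mulEnd B D c)) (add_zero i)).comp
        (Abelian.Ext.mk₀ (mulEnd B D b)) (add_zero i)
    rw [h, ← Abelian.Ext.mk₀_comp_mk₀, Abelian.Ext.comp_assoc_of_third_deg_zero]
  smul_zero b := Abelian.Ext.zero_comp _ _ (Abelian.Ext.mk₀ (mulEnd B D b)) i (add_zero i)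
  smul_add b e₁ e₂ := Abelian.Ext.add_comp _ _ _ _
  add_smul b c e := by
    have h : mulEnd (A := A) B D (b + c) = mulEnd B D b + mulEnd B D c := by
      ext d
      exact add_smul b c (d : D)
    change e.comp (Abelian.Ext.mk₀ (mulEnd B D (b + c))) (add_zero i) =
      e.comp (Abelian.Ext.mk₀ (mulEnd B D b)) (add_zero i) +
        e.comp (Abelian.Ext.mk₀ (mulEnd B D c)) (add_zero i)
    rw [h, Abelian.Ext.mk₀_add, Abelian.Ext.comp_add]
  zero_smul e := by
    have h : mulEnd (A := A) B D 0 = 0 := by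
      ext d
      exact zero_smul B (d : D)
    change e.comp (Abelian.Ext.mk₀ (mulEnd B D 0)) (add_zero i) = 0
    rw [h, Abelian.Ext.mk₀_zero, Abelian.Ext.comp_zero]

/-- `Ext_A^i(X, D)` as a `B`-module. -/
def extObj (X : ModuleCat.{u} A) (i : ℕ) : ModuleCat.{u} B :=
  letI := extModule B D X i
  ModuleCat.of B (Abelian.Ext X (ModuleCat.of A D) i)

/-- The grade of `N`: the infimum of all `i` with `Ext_B^i(N, D) ≠ 0` (it is `⊤` if there are none). -/
def moduleGrade (N : ModuleCat.{u} B) : ℕ∞ :=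
  ⨅ (i : ℕ) (_ : Nontrivial (Abelian.Ext N (ModuleCat.of B D) i)), (i : ℕ∞)

end Dual

section Psi

variable {R : Type u} [Ring R]

/-- The canonical map `P ⟶ P^{**}`, `x ↦ (φ ↦ φ x)`, for a right `R`-module `P`. -/
def bidualMap (P : ModuleCat.{u} Rᵐᵒᵖ) :
    P →ₗ[Rᵐᵒᵖ] dual R Rᵐᵒᵖ R (dual Rᵐᵒᵖ R R P) where
  toFun x :=
    { toFun := fun φ => (φ : P →ₗ[Rᵐᵒᵖ] R) x
      map_add' := fun _ _ => rfl
      map_smul' := fun _ _ => rfl }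
  map_add' x y := LinearMap.ext fun φ => map_add (φ : P →ₗ[Rᵐᵒᵖ] R) x y
  map_smul' a x := LinearMap.ext fun φ => map_smul (φ : P →ₗ[Rᵐᵒᵖ] R) a x

theorem bidualMap_bijective (P : ModuleCat.{u} Rᵐᵒᵖ) [Module.Finite Rᵐᵒᵖ P]
    [Module.Projective Rᵐᵒᵖ P] : Function.Bijective (bidualMap P) := by
  obtain ⟨n, f, g, -, -, hfg⟩ := Module.Finite.exists_comp_eq_id_of_projective Rᵐᵒᵖ P
  let e : Fin n → P := fun i => f (Pi.single i 1)
  let c : Fin n → (P →ₗ[Rᵐᵒᵖ] R) := fun i =>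
    { toFun := fun x => (g x i).unop
      map_add' := fun x y => by simp
      map_smul' := fun a x => by simp [MulOpposite.smul_eq_mul_unop] }
  have hc : ∀ x i, MulOpposite.op (c i x) = g x i := fun x i => rfl
  have hx : ∀ x : P, x = ∑ i, MulOpposite.op (c i x) • e i := by
    intro x
    have h1 : f (g x) = x := LinearMap.congr_fun hfg x
    have h2 : g x = ∑ i, g x i • (Pi.single i 1 : Fin n → Rᵐᵒᵖ) := by
      ext k
      simp [Finset.sum_apply, Pi.single_apply]
    conv_lhs => rw [← h1, h2]
    simp only [map_sum, map_smul, hc, e]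
  constructor
  · intro x y hxy
    have h : ∀ i, c i x = c i y := fun i => LinearMap.congr_fun hxy (c i)
    rw [hx x, hx y]
    simp only [h]
  · intro q
    refine ⟨∑ i, MulOpposite.op ((q : (P →ₗ[Rᵐᵒᵖ] R) →ₗ[R] R) (c i)) • e i, ?_⟩
    apply LinearMap.ext
    intro φ
    have hφ : φ = ∑ i, (φ (e i) : R) • c i := by
      apply LinearMap.ext
      intro y
      conv_lhs => rw [hx y]
      simp [LinearMap.sum_apply, MulOpposite.smul_eq_mul_unop]
    change (φ : P →ₗ[Rᵐᵒᵖ] R) (∑ i, MulOpposite.op ((q : (P →ₗ[Rᵐᵒᵖ] R) →ₗ[R] R) (c i)) • e i) =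
      (q : (P →ₗ[Rᵐᵒᵖ] R) →ₗ[R] R) φ
    conv_rhs => rw [hφ]
    simp [MulOpposite.smul_eq_mul_unop]

variable {M : ModuleCat.{u} Rᵐᵒᵖ}

/-- The isomorphism `P i ≅ (P i)^{**}` for a finitely generated projective resolution `P`. -/
def bidualIso (P : FGResolution M) (i : ℕ) :
    P.obj i ≅ dual R Rᵐᵒᵖ R (dual Rᵐᵒᵖ R R (P.obj i)) :=
  haveI : Module.Finite Rᵐᵒᵖ (P.obj i) := P.finite i
  haveI : Module.Projective Rᵐᵒᵖ (P.obj i) :=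
    (IsProjective.iff_projective (P.obj i)).mpr (P.projective i)
  (LinearEquiv.ofBijective (bidualMap (P.obj i)) (bidualMap_bijective _)).toModuleIso

theorem bidualIso_naturality (P : FGResolution M) (i : ℕ) :
    dualMap Rᵐᵒᵖ R (dualMap R R (P.diff i)) ≫ (bidualIso P i).inv =
      (bidualIso P (i + 1)).inv ≫ P.diff i := by
  rw [Iso.comp_inv_eq, Category.assoc, Iso.eq_inv_comp]
  rfl

/-- A resolution of `Tr Ω^n M` by finitely generated projective left modules, where
`Tr Ω^n M = Cok (P n ^* ⟶ P (n + 1) ^*)`. -/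
abbrev TrResolution (P : FGResolution M) (n : ℕ) := FGResolution (trSyzygy R R P n)

/-- The module `J_n^2 M = Tr Ω^n Tr Ω^n M = Cok (Q n ^* ⟶ Q (n + 1) ^*)`, computed from the
resolution `Q` of `Tr Ω^n M`. -/
abbrev jSquare (P : FGResolution M) (n : ℕ) (Q : TrResolution P n) : ModuleCat.{u} Rᵐᵒᵖ :=
  trSyzygy Rᵐᵒᵖ R Q n

/-- A chain map from `P 0 ^* ⟶ P 1 ^* ⟶ ⋯ ⟶ P n ^* ⟶ P (n + 1) ^* ⟶ Tr Ω^n M` to the resolution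
`Q (n + 1) ⟶ Q n ⟶ ⋯ ⟶ Q 1 ⟶ Q 0 ⟶ Tr Ω^n M` over the identity of `Tr Ω^n M`.  The component from
`P m ^*` to `Q k` is indexed by the pair `k`, `m` with `k + m = n + 1`. -/
structure PsiLift (P : FGResolution M) (n : ℕ) (Q : TrResolution P n) where
  map : ∀ k m : ℕ, k + m = n + 1 → (dual Rᵐᵒᵖ R R (P.obj m) ⟶ Q.obj k)
  comm : ∀ (k m : ℕ) (h : k + 1 + m = n + 1),
    map (k + 1) m h ≫ Q.diff k = dualMap R R (P.diff m) ≫ map k (m + 1) (by omega)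
  comm_aug : map 0 (n + 1) (by omega) ≫ Q.aug = Limits.cokernel.π (dualMap R R (P.diff n))

/-- The natural map `ψ_M^n : J_n^2 M ⟶ M`, obtained from the commutative diagram with exact rows
`Q n ^* ⟶ Q (n + 1) ^* ⟶ J_n^2 M ⟶ 0` and `P 1 ⟶ P 0 ⟶ M ⟶ 0` that arises by dualizing the two
last components of the chain map `F` and identifying `P i ^{**}` with `P i`. -/
def psi (P : FGResolution M) (n : ℕ) (Q : TrResolution P n) (F : PsiLift P n Q) :
    jSquare P n Q ⟶ M :=
  Limits.cokernel.desc (dualMap Rᵐᵒᵖ R (Q.diff n))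
    (dualMap Rᵐᵒᵖ R (F.map (n + 1) 0 rfl) ≫ (bidualIso P 0).inv ≫ P.aug) (by
      have h := F.comm n 0 rfl
      rw [← Category.assoc, ← dualMap_comp, h, dualMap_comp, Category.assoc,
        ← Category.assoc (dualMap Rᵐᵒᵖ R (dualMap R R (P.diff 0))), bidualIso_naturality,
        Category.assoc, P.diff_aug, Limits.comp_zero, Limits.comp_zero])

/-- The map `Tr Ω^n M ⟶ P (n + 2) ^*` induced by `P (n + 1) ^* ⟶ P (n + 2) ^*`. -/
def trSyzygyToDual (P : FGResolution M) (n : ℕ) :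
    trSyzygy R R P n ⟶ dual Rᵐᵒᵖ R R (P.obj (n + 2)) :=
  Limits.cokernel.desc (dualMap R R (P.diff n)) (dualMap R R (P.diff (n + 1))) (by
    rw [← dualMap_comp, P.diff_diff, dualMap_zero])

/-- A chain map from `⋯ ⟶ Q 1 ⟶ Q 0 ⟶ P (n + 2) ^* ⟶ Tr Ω^{n+1} M` to the resolution
`⋯ ⟶ Q' 2 ⟶ Q' 1 ⟶ Q' 0 ⟶ Tr Ω^{n+1} M` over the identity of `Tr Ω^{n+1} M`.  Here `Q` resolves
`Tr Ω^n M`, and `Q 0 ⟶ P (n + 2) ^*` is the composite `Q 0 ⟶ Tr Ω^n M ⟶ P (n + 2) ^*`. -/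
structure PsiStepLift (P : FGResolution M) (n : ℕ) (Q : TrResolution P n)
    (Q' : TrResolution P (n + 1)) where
  base : dual Rᵐᵒᵖ R R (P.obj (n + 2)) ⟶ Q'.obj 0
  map : ∀ k : ℕ, Q.obj k ⟶ Q'.obj (k + 1)
  base_aug : base ≫ Q'.aug = Limits.cokernel.π (dualMap R R (P.diff (n + 1)))
  comm_zero : map 0 ≫ Q'.diff 0 = Q.aug ≫ trSyzygyToDual P n ≫ base
  comm : ∀ k : ℕ, map (k + 1) ≫ Q'.diff (k + 1) = Q.diff k ≫ map k

/-- The natural map `ψ_M^{n+1,n} : J_{n+1}^2 M ⟶ J_n^2 M`, obtained by dualizing the components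
`Q n ⟶ Q' (n + 1)` and `Q (n + 1) ⟶ Q' (n + 2)` of the chain map `G`. -/
def psiStep (P : FGResolution M) (n : ℕ) (Q : TrResolution P n) (Q' : TrResolution P (n + 1))
    (G : PsiStepLift P n Q Q') : jSquare P (n + 1) Q' ⟶ jSquare P n Q :=
  Limits.cokernel.map (dualMap Rᵐᵒᵖ R (Q'.diff (n + 1))) (dualMap Rᵐᵒᵖ R (Q.diff n))
    (dualMap Rᵐᵒᵖ R (G.map n)) (dualMap Rᵐᵒᵖ R (G.map (n + 1)))
    (by rw [← dualMap_comp, ← dualMap_comp, G.comm])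

end Psi

end StableModule

end

open StableModule

/-! Write `T i` for `Tr Ω^i M`. The map `T i ⟶ P (i + 2)^*` has kernel `Ext^(i+1)(M, R)`, and its
image `I i` is a first syzygy of `T (i + 1)`. This gives `0 ⟶ Ext^(i+1)(M, R) ⟶ T i ⟶ I i ⟶ 0` and
`0 ⟶ I i ⟶ P (i + 2)^* ⟶ T (i + 1) ⟶ 0`.

By the first sequence, a lower bound on the grade of `Ext^(i+1)(M, R)` says that `Ext^m(I i, R) ⟶
Ext^m(T i, R)` is surjective, respectively injective, in a range of degrees
(`le_moduleGrade_extObj_iff`). By the second, `Ext^m(I i, R)` is `Ext^(m+1)(T (i + 1), R)` for `m ≥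
1`. In degrees up to `i` the grade conditions therefore encode the torsionfreeness of the syzygies.
In degrees above `i` they say that `T i ⟶ I i` satisfies a version of `(T_j)` shifted by `i`
(`grade_iff_torsionfree_and_extCondition`).

Transposing `ψ^{i+1,i}` gives, up to isomorphism, a map `beta : Ω^i T i ⟶ Ω^(i+1) T (i + 1)`. It is
obtained from `T i ⟶ I i` by passing to `i`-th syzygies, so dimension shifting identifies its
condition with the shifted one (`PsiStepLift.extCondition_beta`). Hence 1 and 3 are equivalent.

Transposing `ψ^i` gives `alpha : Tr M ⟶ Ω^i T i`. Up to maps through projectives, the next `alpha`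
is the previous one followed by `beta`, and the one for `i = 0` is an isomorphism. Induction on `i`
gives the equivalence of 2 and 3 (`extCondition_alpha_iff_beta`). -/

open Abelian

namespace StableModule

/-! ### Stable equality, dimension shifting and maps induced on Ext. -/

section ExtPre

universe w v v'

variable {C : Type v'} [Category.{v} C] [Abelian C]

/-- Two morphisms are stably equal if their difference factors through a projective object. -/
def StablyEq {X X' : C} (f g : X ⟶ X') : Prop :=
  ∃ (Z : C) (_ : Projective Z) (a : X ⟶ Z) (b : Z ⟶ X'), f = g + a ≫ b

theorem StablyEq.of_eq {X X' : C} {f g : X ⟶ X'} (h : f = g) : StablyEq f g :=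
  open ZeroObject in ⟨0, inferInstance, 0, 0, by simp [h]⟩

variable [HasExt.{w} C]

/-- Precomposition with `f : X ⟶ X'` on `Ext^m(-, Y)`. -/
noncomputable def extPre {X X' : C} (Y : C) (f : X ⟶ X') (m : ℕ) : Ext X' Y m → Ext X Y m :=
  fun e => (Ext.mk₀ f).comp e (zero_add m)

variable {X X' X'' : C} (Y : C)

theorem extPre_comp (f : X ⟶ X') (g : X' ⟶ X'') (m : ℕ) :
    extPre Y (f ≫ g) m = extPre Y f m ∘ extPre Y g m := by
  funext e
  simp [extPre]

theorem extPre_id (m : ℕ) : extPre Y (𝟙 X) m = id := by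
  funext e
  simp [extPre]

theorem extPre_zero_right (f : X ⟶ X') (m : ℕ) : extPre Y f m 0 = 0 := by
  simp [extPre]

theorem extPre_sub (f : X ⟶ X') (m : ℕ) (a b : Ext X' Y m) :
    extPre Y f m (a - b) = extPre Y f m a - extPre Y f m b := by
  simp [extPre, sub_eq_add_neg]

theorem extPre_injective_iff (f : X ⟶ X') (m : ℕ) :
    Function.Injective (extPre Y f m) ↔ ∀ e, extPre Y f m e = 0 → e = 0 := by
  constructor
  · intro h e he
    exact h (he.trans (extPre_zero_right Y f m).symm)
  · intro h a b hab
    exact sub_eq_zero.mp (h _ (by rw [extPre_sub, hab, sub_self]))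

/-- The difference of the two induced maps passes through `Ext^m` of a projective object, which
vanishes in positive degrees. -/
theorem StablyEq.extPre_eq {f g : X ⟶ X'} (h : StablyEq f g) {m : ℕ} (hm : 1 ≤ m) :
    extPre Y f m = extPre Y g m := by
  obtain ⟨Z, hZ, a, b, rfl⟩ := h
  obtain ⟨m, rfl⟩ := Nat.exists_eq_add_of_le' hm
  funext e
  simp only [extPre, Ext.mk₀_add, Ext.add_comp, add_eq_left, ← Ext.mk₀_comp_mk₀_assoc]
  rw [Ext.eq_zero_of_projective ((Ext.mk₀ b).comp e (zero_add (m + 1))), Ext.comp_zero]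

theorem extPre_bijective_of_stably_inverse {f : X ⟶ X'} {g : X' ⟶ X}
    (hfg : StablyEq (f ≫ g) (𝟙 X)) (hgf : StablyEq (g ≫ f) (𝟙 X')) {m : ℕ} (hm : 1 ≤ m) :
    Function.Bijective (extPre Y f m) := by
  have h1 := hfg.extPre_eq Y hm
  have h2 := hgf.extPre_eq Y hm
  rw [extPre_comp, extPre_id] at h1 h2
  exact Function.bijective_iff_has_inverse.mpr
    ⟨extPre Y g m, congrFun h2, congrFun h1⟩

theorem extPre_bijective_of_isIso (f : X ⟶ X') [IsIso f] (m : ℕ) :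
    Function.Bijective (extPre Y f m) := by
  refine Function.bijective_iff_has_inverse.mpr ⟨extPre Y (inv f) m, fun e => ?_, fun e => ?_⟩
  · rw [← Function.comp_apply (f := extPre Y (inv f) m), ← extPre_comp, IsIso.inv_hom_id,
      extPre_id, id]
  · rw [← Function.comp_apply (f := extPre Y f m), ← extPre_comp, IsIso.hom_inv_id,
      extPre_id, id]

/-- The maps `Ext^(k + s)(f, Y)` are bijective for `1 ≤ k < j` and injective for `k = j ≥ 1`. -/
def ExtCondition {X X' : C} (Y : C) (f : X ⟶ X') (s j : ℕ) : Prop :=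
  ∀ k : ℕ, 1 ≤ k → (k < j → Function.Bijective (extPre Y f (k + s))) ∧
    (k = j → Function.Injective (extPre Y f (k + s)))

/-- The two shifts `s₁` and `s₂` are independent so that the comparison maps `p`, `q` may be
connecting maps, which change the degree, as well as maps induced by morphisms. -/
theorem extCondition_congr {X₁ X₁' X₂ X₂' : C} {f₁ : X₁ ⟶ X₁'} {f₂ : X₂ ⟶ X₂'} {s₁ s₂ : ℕ} (j : ℕ)
    (h : ∀ k : ℕ, 1 ≤ k → ∃ (p : Ext X₂ Y (k + s₂) → Ext X₁ Y (k + s₁))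
      (q : Ext X₂' Y (k + s₂) → Ext X₁' Y (k + s₁)),
      Function.Bijective p ∧ Function.Bijective q ∧
        p ∘ extPre Y f₂ (k + s₂) = extPre Y f₁ (k + s₁) ∘ q) :
    ExtCondition Y f₁ s₁ j ↔ ExtCondition Y f₂ s₂ j := by
  refine forall₂_congr fun k hk => ?_
  obtain ⟨p, q, hp, hq, hpq⟩ := h k hk
  have h1 : Function.Bijective (extPre Y f₁ (k + s₁)) ↔
      Function.Bijective (extPre Y f₂ (k + s₂)) := by
    rw [← Function.Bijective.of_comp_iff _ hq, ← hpq, Function.Bijective.of_comp_iff' hp]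
  have h2 : Function.Injective (extPre Y f₁ (k + s₁)) ↔
      Function.Injective (extPre Y f₂ (k + s₂)) := by
    rw [← Function.Injective.of_comp_iff' _ hq, ← hpq, hp.1.of_comp_iff]
  rw [h1, h2]

theorem extCondition_of_stable_square {X₁ X₁' X₂ X₂' : C} {f₁ : X₁ ⟶ X₁'} {f₂ : X₂ ⟶ X₂'}
    {a : X₁ ⟶ X₂} {b : X₁' ⟶ X₂'} (s j : ℕ) (h : StablyEq (a ≫ f₂) (f₁ ≫ b))
    (ha : ∀ m, 1 ≤ m → Function.Bijective (extPre Y a m))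
    (hb : ∀ m, 1 ≤ m → Function.Bijective (extPre Y b m)) :
    ExtCondition Y f₁ s j ↔ ExtCondition Y f₂ s j :=
  extCondition_congr Y j fun k hk => ⟨extPre Y a (k + s), extPre Y b (k + s), ha _ (by omega),
    hb _ (by omega), by rw [← extPre_comp, h.extPre_eq Y (by omega), extPre_comp]⟩

/-- Precomposition with the class of a short exact sequence. -/
noncomputable def connecting {S : ShortComplex C} (hS : S.ShortExact) (m : ℕ) :
    Ext S.X₁ Y m → Ext S.X₃ Y (m + 1) :=
  fun e => hS.extClass.comp e (add_comm 1 m)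

/-- Dimension shifting: the neighbouring terms `Ext^m(S.X₂, Y)` and `Ext^(m+1)(S.X₂, Y)` of the long
exact sequence vanish. In degree `0` injectivity may fail, because of morphisms that extend to
`S.X₂`. -/
theorem connecting_bijective {S : ShortComplex C} (hS : S.ShortExact) [Projective S.X₂] {m : ℕ}
    (hm : 1 ≤ m) : Function.Bijective (connecting Y hS m) := by
  obtain ⟨m, rfl⟩ := Nat.exists_eq_add_of_le' hm
  constructor
  · intro a b hab
    have h : hS.extClass.comp (a - b) (add_comm 1 (m + 1)) = 0 := by
      rw [sub_eq_add_neg, Ext.comp_add, Ext.comp_neg, ← sub_eq_add_neg, sub_eq_zero]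
      exact hab
    obtain ⟨x, hx⟩ := Ext.contravariant_sequence_exact₁ hS Y (a - b) _ h
    rw [Ext.eq_zero_of_projective x, Ext.comp_zero] at hx
    exact sub_eq_zero.mp hx.symm
  · intro x
    exact Ext.contravariant_sequence_exact₃ hS Y x (Ext.eq_zero_of_projective _) _

theorem connecting_naturality {S₁ S₂ : ShortComplex C} (h₁ : S₁.ShortExact) (h₂ : S₂.ShortExact)
    (f : S₁ ⟶ S₂) (m : ℕ) :
    connecting Y h₁ m ∘ extPre Y f.τ₁ m = extPre Y f.τ₃ (m + 1) ∘ connecting Y h₂ m := by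
  funext e
  simp only [connecting, extPre, Function.comp_apply]
  rw [← Ext.comp_assoc _ _ _ (add_zero 1) (zero_add m) (by omega),
    ShortComplex.ShortExact.extClass_naturality h₁ h₂ f,
    Ext.comp_assoc _ _ _ (zero_add 1) (add_comm 1 m) (by omega)]

theorem extCondition_shift {S₁ S₂ : ShortComplex C} (h₁ : S₁.ShortExact) (h₂ : S₂.ShortExact)
    [Projective S₁.X₂] [Projective S₂.X₂] (f : S₁ ⟶ S₂) (s j : ℕ) :
    ExtCondition Y f.τ₃ (s + 1) j ↔ ExtCondition Y f.τ₁ s j :=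
  extCondition_congr Y j fun k hk => ⟨connecting Y h₁ (k + s), connecting Y h₂ (k + s),
    connecting_bijective Y h₁ (by omega), connecting_bijective Y h₂ (by omega),
    connecting_naturality Y h₁ h₂ f (k + s)⟩

/-- Two first syzygies of the same object have the same positive Ext, since both compute Ext of that
object one degree higher. The map `f.τ₁` itself need not be an isomorphism. -/
theorem extPre_bijective_of_shift {S₁ S₂ : ShortComplex C} (h₁ : S₁.ShortExact)
    (h₂ : S₂.ShortExact) [Projective S₁.X₂] [Projective S₂.X₂] (f : S₁ ⟶ S₂) [IsIso f.τ₃] {m : ℕ}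
    (hm : 1 ≤ m) : Function.Bijective (extPre Y f.τ₁ m) := by
  rw [← Function.Bijective.of_comp_iff' (connecting_bijective Y h₁ hm),
    connecting_naturality Y h₁ h₂ f]
  exact (extPre_bijective_of_isIso Y f.τ₃ _).comp (connecting_bijective Y h₂ hm)

theorem subsingleton_ext_shift {S : ShortComplex C} (hS : S.ShortExact) [Projective S.X₂] {m : ℕ}
    (hm : 1 ≤ m) : Subsingleton (Ext S.X₁ Y m) ↔ Subsingleton (Ext S.X₃ Y (m + 1)) :=
  (Equiv.ofBijective _ (connecting_bijective Y hS hm)).subsingleton_congr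

/-- For a short exact sequence `0 ⟶ E ⟶ T ⟶ W ⟶ 0`, the groups `Ext^m(E, Y)` vanish in degrees below
`N` if and only if `Ext^m(W, Y) ⟶ Ext^m(T, Y)` is surjective for `m < N` and injective for
`1 ≤ m ≤ N`. -/
theorem subsingleton_ext_iff {S : ShortComplex C} (hS : S.ShortExact) (N : ℕ) :
    (∀ m < N, Subsingleton (Ext S.X₁ Y m)) ↔
      (∀ m, m < N → Function.Surjective (extPre Y S.g m)) ∧
        (∀ m, 1 ≤ m → m ≤ N → Function.Injective (extPre Y S.g m)) := by
  constructor
  · intro h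
    refine ⟨fun m hm x => ?_, fun m hm1 hm => ?_⟩
    · have := h m hm
      exact Ext.contravariant_sequence_exact₂ hS Y x (Subsingleton.elim _ _)
    · obtain ⟨m, rfl⟩ := Nat.exists_eq_add_of_le' hm1
      have := h m (by omega)
      rw [extPre_injective_iff]
      intro e he
      obtain ⟨x, hx⟩ := Ext.contravariant_sequence_exact₃ hS Y e he (add_comm 1 m)
      rw [← hx, Subsingleton.elim x 0, Ext.comp_zero]
  · rintro ⟨hs, hi⟩ m hm
    refine subsingleton_of_forall_eq 0 fun x => ?_
    -- The image of `x` under the connecting map dies in `Ext^(m+1)(S.X₂, Y)`, so it is zero by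
    -- injectivity. Thus `x` is the restriction of some `y`, and `y` is pulled back from `S.X₃` by
    -- surjectivity; the restriction of such a class to `S.X₁` is zero.
    have hx : hS.extClass.comp x (add_comm 1 m) = 0 := by
      refine (extPre_injective_iff Y S.g (m + 1)).mp (hi (m + 1) (by omega) (by omega)) _ ?_
      simp [extPre]
    obtain ⟨y, hy⟩ := Ext.contravariant_sequence_exact₁ hS Y x _ hx
    obtain ⟨z, hz⟩ := hs m hm y
    rw [← hy, ← hz, extPre, ← Ext.comp_assoc_of_second_deg_zero, Ext.mk₀_comp_mk₀, S.zero,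
      Ext.mk₀_zero, Ext.zero_comp]

end ExtPre

/-! ### Transposes computed from presentations, and independence of the choices. -/

section Presentation

theorem projective_of_projectiveModule {A : Type u} [Ring A] (X : ModuleCat.{u} A)
    [Module.Projective A X] : Projective X :=
  (IsProjective.iff_projective X).mp inferInstance

variable {A : Type u} [Ring A]

/-- A presentation `P₁ ⟶ P₀ ⟶ X ⟶ 0` by projective modules with `P₁` finitely generated. -/
structure Presentation (X : ModuleCat.{u} A) where
  P₁ : ModuleCat.{u} A
  P₀ : ModuleCat.{u} A
  d : P₁ ⟶ P₀
  ε : P₀ ⟶ X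
  w : d ≫ ε = 0
  exact : (ShortComplex.mk d ε w).Exact
  epi : Epi ε
  projective₁ : Projective P₁
  projective₀ : Projective P₀
  finite₁ : Module.Finite A P₁

namespace Presentation

/-- A lift of `f : X ⟶ Y` to presentations. -/
structure Hom {X Y : ModuleCat.{u} A} (p : Presentation X) (q : Presentation Y) (f : X ⟶ Y) where
  f₁ : p.P₁ ⟶ q.P₁
  f₀ : p.P₀ ⟶ q.P₀
  comm : f₁ ≫ q.d = p.d ≫ f₀
  comm_ε : f₀ ≫ q.ε = p.ε ≫ f

variable {X Y Z : ModuleCat.{u} A}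

/-- The lift of an identity morphism. -/
@[simps] def Hom.id (p : Presentation X) : Hom p p (𝟙 X) where
  f₁ := 𝟙 _
  f₀ := 𝟙 _
  comm := by simp
  comm_ε := by simp

/-- The composition of two lifts. -/
@[simps] def Hom.comp {p : Presentation X} {q : Presentation Y} {r : Presentation Z} {f : X ⟶ Y}
    {g : Y ⟶ Z} (a : Hom p q f) (b : Hom q r g) : Hom p r (f ≫ g) where
  f₁ := a.f₁ ≫ b.f₁
  f₀ := a.f₀ ≫ b.f₀
  comm := by rw [Category.assoc, b.comm, ← Category.assoc, a.comm, Category.assoc]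
  comm_ε := by rw [Category.assoc, b.comm_ε, ← Category.assoc, a.comm_ε, Category.assoc]

theorem Hom.nonempty (p : Presentation X) (q : Presentation Y) (f : X ⟶ Y) :
    Nonempty (Hom p q f) := by
  have := p.projective₀
  have := p.projective₁
  have := q.epi
  have h : (p.d ≫ Projective.factorThru (p.ε ≫ f) q.ε) ≫ q.ε = 0 := by
    rw [Category.assoc, Projective.factorThru_comp, ← Category.assoc, p.w, Limits.zero_comp]
  exact ⟨⟨q.exact.liftFromProjective _ h, Projective.factorThru (p.ε ≫ f) q.ε,
    q.exact.liftFromProjective_comp _ h, Projective.factorThru_comp _ _⟩⟩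

variable (B D : Type u) [Ring B] [AddCommGroup D] [Module A D] [Module B D] [SMulCommClass A B D]

/-- The transpose computed from a presentation. -/
noncomputable def tr (p : Presentation X) : ModuleCat.{u} B :=
  Limits.cokernel (dualMap B D p.d)

/-- The projection from `P₁^*` to the transpose. -/
noncomputable def trπ (p : Presentation X) : dual A B D p.P₁ ⟶ p.tr B D :=
  Limits.cokernel.π (dualMap B D p.d)

instance (p : Presentation X) : Epi (p.trπ B D) :=
  inferInstanceAs (Epi (Limits.cokernel.π (dualMap B D p.d)))

theorem dualMap_d_trπ (p : Presentation X) : dualMap B D p.d ≫ p.trπ B D = 0 :=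
  Limits.cokernel.condition _

/-- The morphism from the transpose induced by a morphism from `P₁^*`. -/
noncomputable def trDesc (p : Presentation X) {W : ModuleCat.{u} B} (g : dual A B D p.P₁ ⟶ W)
    (hg : dualMap B D p.d ≫ g = 0) : p.tr B D ⟶ W :=
  Limits.cokernel.desc _ g hg

theorem trπ_trDesc (p : Presentation X) {W : ModuleCat.{u} B} (g : dual A B D p.P₁ ⟶ W)
    (hg : dualMap B D p.d ≫ g = 0) : p.trπ B D ≫ p.trDesc B D g hg = g :=
  Limits.cokernel.π_desc _ _ _

/-- The map between transposes given by a lift to presentations. -/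
noncomputable def Hom.tr {p : Presentation X} {q : Presentation Y} {f : X ⟶ Y} (a : Hom p q f) :
    q.tr B D ⟶ p.tr B D :=
  Limits.cokernel.map (dualMap B D q.d) (dualMap B D p.d) (dualMap B D a.f₀) (dualMap B D a.f₁)
    (by rw [← dualMap_comp, ← dualMap_comp, a.comm])

theorem trπ_tr {p : Presentation X} {q : Presentation Y} {f : X ⟶ Y} (a : Hom p q f) :
    q.trπ B D ≫ a.tr B D = dualMap B D a.f₁ ≫ p.trπ B D :=
  Limits.cokernel.π_desc _ _ _

theorem Hom.tr_comp {p : Presentation X} {q : Presentation Y} {r : Presentation Z} {f : X ⟶ Y}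
    {g : Y ⟶ Z} (a : Hom p q f) (b : Hom q r g) :
    (a.comp b).tr B D = b.tr B D ≫ a.tr B D := by
  rw [← cancel_epi (r.trπ B D), trπ_tr, ← Category.assoc, trπ_tr,
    Category.assoc, trπ_tr, comp_f₁, dualMap_comp, Category.assoc]

theorem Hom.tr_id (p : Presentation X) : (Hom.id p).tr B D = 𝟙 (p.tr B D) := by
  rw [← cancel_epi (p.trπ B D), trπ_tr, id_f₁, Category.comp_id]
  rfl

end Presentation

section

variable (B D : Type u) [Ring B] [AddCommGroup D] [Module A D] [Module B D] [SMulCommClass A B D]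

theorem dualMap_add {X Y : ModuleCat.{u} A} (f g : X ⟶ Y) :
    dualMap B D (f + g) = dualMap B D f + dualMap B D g := by
  ext φ x
  exact map_add (φ : Y →ₗ[A] D) (f x) (g x)

/-- The dual of a finitely generated projective module is a direct summand of some `D^n`. -/
theorem exists_dual_retract (X : ModuleCat.{u} A) [Module.Finite A X] [Module.Projective A X] :
    ∃ (n : ℕ) (s : (X →ₗ[A] D) →ₗ[B] (Fin n → D)) (r : (Fin n → D) →ₗ[B] (X →ₗ[A] D)),
      r ∘ₗ s = LinearMap.id := by
  obtain ⟨n, f, g, -, -, hfg⟩ := Module.Finite.exists_comp_eq_id_of_projective A X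
  refine ⟨n,
    { toFun := fun φ i => φ (f (Pi.single i 1))
      map_add' := fun _ _ => rfl
      map_smul' := fun _ _ => rfl },
    { toFun := fun v =>
        { toFun := fun x => ∑ i, g x i • v i
          map_add' := fun x y => by simp [add_smul, Finset.sum_add_distrib]
          map_smul' := fun a x => by simp [mul_smul, Finset.smul_sum] }
      map_add' := fun v w => by ext x; simp [Finset.sum_add_distrib]
      map_smul' := fun b v => by ext x; simp [Finset.smul_sum, smul_comm] }, ?_⟩
  ext φ x
  -- Dual basis identity: `φ x` is recovered from the values of `φ` on the generators `f (Pi.single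
  -- i 1)`, with the coordinates of `g x` as coefficients.
  have h := LinearMap.pi_apply_eq_sum_univ (φ ∘ₗ f) (g x)
  have h1 : f (g x) = x := LinearMap.congr_fun hfg x
  rw [LinearMap.comp_apply, h1] at h
  change ∑ i, g x i • φ (f (Pi.single i 1)) = φ x
  rw [h]
  refine Finset.sum_congr rfl fun i _ => ?_
  have h2 : (Pi.single i 1 : Fin n → A) = fun j => if i = j then 1 else 0 := by
    funext j
    simp [Pi.single_apply, eq_comm]
  rw [h2, LinearMap.comp_apply]

theorem projective_dual [Module.Projective B D] (X : ModuleCat.{u} A) [Module.Finite A X]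
    [Module.Projective A X] : Module.Projective B (dual A B D X) := by
  obtain ⟨n, s, r, h⟩ := exists_dual_retract B D X
  have : Module.Projective B (Fin n → D) := Module.Projective.of_equiv'
    (DFinsupp.linearEquivFunOnFintype (R := B) (M := fun _ : Fin n => D))
  exact Module.Projective.of_split (P := X →ₗ[A] D) s r h

theorem finite_dual [Module.Finite B D] (X : ModuleCat.{u} A) [Module.Finite A X]
    [Module.Projective A X] : Module.Finite B (dual A B D X) := by
  obtain ⟨n, s, r, h⟩ := exists_dual_retract B D X
  exact Module.Finite.of_surjective (M := Fin n → D) (P := X →ₗ[A] D) r fun x =>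
    ⟨s x, LinearMap.congr_fun h x⟩

/-- Lifts of the same morphism to presentations have stably equal transposes. -/
theorem Presentation.Hom.stablyEq_tr [Module.Projective B D] {X Y : ModuleCat.{u} A}
    {p : Presentation X} {q : Presentation Y} {f : X ⟶ Y} (a b : Hom p q f) :
    StablyEq (a.tr B D) (b.tr B D) := by
  have := p.projective₀
  have := p.finite₁
  have := (IsProjective.iff_projective p.P₁).mpr p.projective₁
  have := projective_dual B D p.P₁
  have h0 : (a.f₀ - b.f₀) ≫ q.ε = 0 := by
    rw [Preadditive.sub_comp, a.comm_ε, b.comm_ε, sub_self]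
  let h := q.exact.liftFromProjective (a.f₀ - b.f₀) h0
  have hh : h ≫ q.d = a.f₀ - b.f₀ := q.exact.liftFromProjective_comp _ h0
  -- Since `h` is a homotopy on `P₀`, `s` takes values in the kernel of `q.d`, and so its dual
  -- descends to `q.tr`. The remaining part `p.d ≫ h` dualizes into the image of `dualMap B D p.d`,
  -- which is zero in `p.tr`. The difference of the transposes thus factors through the projective
  -- module `P₁^*`.
  let s := a.f₁ - b.f₁ - p.d ≫ h
  have hs : s ≫ q.d = 0 := by
    simp only [s, Preadditive.sub_comp, Category.assoc, hh, a.comm, b.comm, Preadditive.comp_sub,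
      sub_self]
  have hs' : dualMap B D q.d ≫ dualMap B D s = 0 := by
    rw [← dualMap_comp, hs, dualMap_zero]
  have ha : a.f₁ = b.f₁ + (s + p.d ≫ h) := by
    simp only [s]
    abel
  refine ⟨dual A B D p.P₁, projective_of_projectiveModule _, q.trDesc B D _ hs',
    p.trπ B D, ?_⟩
  rw [← cancel_epi (q.trπ B D), Preadditive.comp_add, trπ_tr, trπ_tr, ← Category.assoc,
    trπ_trDesc, ha, dualMap_add, dualMap_add, dualMap_comp, Preadditive.add_comp,
    Preadditive.add_comp,
    Category.assoc, dualMap_d_trπ, Limits.comp_zero, add_zero]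

/-- Lifts of the identity in both directions compose to lifts of the identity, so their transposes
are stably inverse to each other. -/
theorem Presentation.Hom.extPre_tr_bijective [Module.Projective B D] {X : ModuleCat.{u} A}
    {p q : Presentation X} (a : Hom p q (𝟙 X)) (Y : ModuleCat.{u} B) {m : ℕ} (hm : 1 ≤ m) :
    Function.Bijective (extPre Y (a.tr B D) m) := by
  obtain ⟨b⟩ := Hom.nonempty q p (𝟙 X)
  have key : ∀ {p q : Presentation X} (a : Hom p q (𝟙 X)) (b : Hom q p (𝟙 X)),
      StablyEq (a.tr B D ≫ b.tr B D) (𝟙 _) := fun {p q} a b => by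
    rw [← Hom.tr_comp, ← Hom.tr_id]
    have := (b.comp a).stablyEq_tr B D ⟨𝟙 _, 𝟙 _, by simp, by simp⟩
    exact this
  exact extPre_bijective_of_stably_inverse Y (key a b) (key b a) hm

/-- This makes `(T_j)` independent of the presentations and of the lift. Changing presentations at
both ends gives a square whose two composites are transposes of lifts of the same `f`, hence stably
equal. -/
theorem Presentation.Hom.extCondition_tr_iff [Module.Projective B D] {X Y : ModuleCat.{u} A}
    {p p' : Presentation X} {q q' : Presentation Y} {f : X ⟶ Y} (a : Hom p q f) (a' : Hom p' q' f)
    (Z : ModuleCat.{u} B) (s j : ℕ) :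
    ExtCondition Z (a.tr B D) s j ↔ ExtCondition Z (a'.tr B D) s j := by
  obtain ⟨u⟩ := Hom.nonempty p' p (𝟙 X)
  obtain ⟨v⟩ := Hom.nonempty q' q (𝟙 Y)
  refine extCondition_of_stable_square Z (a := v.tr B D) (b := u.tr B D) s j ?_
    (fun m hm => v.extPre_tr_bijective B D Z hm) (fun m hm => u.extPre_tr_bijective B D Z hm)
  rw [← tr_comp, ← tr_comp]
  -- The two composites lift `f ≫ 𝟙 Y` and `𝟙 X ≫ f`; both are repackaged as lifts of `f` itself so
  -- that they can be compared.
  let c : Hom p' q f := ⟨(a'.comp v).f₁, (a'.comp v).f₀, (a'.comp v).comm,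
    by rw [(a'.comp v).comm_ε, Category.comp_id]⟩
  let c' : Hom p' q f := ⟨(u.comp a).f₁, (u.comp a).f₀, (u.comp a).comm,
    by rw [(u.comp a).comm_ε, Category.id_comp]⟩
  exact c.stablyEq_tr B D c'

/-- The presentation that is part of a resolution. -/
def FGResolution.presentation {X : ModuleCat.{u} A} (P : FGResolution X) : Presentation X where
  P₁ := P.obj 1
  P₀ := P.obj 0
  d := P.diff 0
  ε := P.aug
  w := P.diff_aug
  exact := P.toProjectiveResolution.exact₀
  epi := inferInstanceAs (Epi (P.π.f 0))
  projective₁ := P.projective 1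
  projective₀ := P.projective 0
  finite₁ := P.finite 1

/-- The lift of `f` to resolutions, restricted to presentations. -/
noncomputable def FGResolution.liftPresentation {X Y : ModuleCat.{u} A} (P : FGResolution X)
    (Q : FGResolution Y) (f : X ⟶ Y) : P.presentation.Hom Q.presentation f where
  f₁ := (ProjectiveResolution.lift f P.toProjectiveResolution Q.toProjectiveResolution).f 1
  f₀ := (ProjectiveResolution.lift f P.toProjectiveResolution Q.toProjectiveResolution).f 0
  comm := HomologicalComplex.Hom.comm _ 1 0
  comm_ε := ProjectiveResolution.lift_commutes_zero f _ _

theorem extCondition_transposeMap_iff [Module.Projective B D] {X Y : ModuleCat.{u} A}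
    {p : Presentation X} {q : Presentation Y} {f : X ⟶ Y} (a : p.Hom q f)
    (P : FGResolution X) (Q : FGResolution Y) (j : ℕ) :
    (∀ i : ℕ, 1 ≤ i →
      (i < j → Function.Bijective (extMap B D (transposeMap B D P Q f) i)) ∧
      (i = j → Function.Injective (extMap B D (transposeMap B D P Q f) i))) ↔
    ExtCondition (ModuleCat.of B D) (a.tr B D) 0 j :=
  (P.liftPresentation Q f).extCondition_tr_iff B D a (ModuleCat.of B D) 0 j

theorem subsingleton_ext_transpose_iff [Module.Projective B D] {X : ModuleCat.{u} A}
    (p : Presentation X) (P : FGResolution X) (Y : ModuleCat.{u} B) {m : ℕ} (hm : 1 ≤ m) :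
    Subsingleton (Ext (transpose B D P) Y m) ↔ Subsingleton (Ext (p.tr B D) Y m) := by
  obtain ⟨u⟩ := Presentation.Hom.nonempty p P.presentation (𝟙 X)
  exact (Equiv.ofBijective _ (u.extPre_tr_bijective B D Y hm)).subsingleton_congr.symm

end

end Presentation

/-! ### Existence of resolutions over a noetherian ring. -/

section Existence

variable {A : Type u} [Ring A]

/-- A finitely generated module over a noetherian ring has a resolution by finitely generated
projective modules. -/
theorem FGResolution.nonempty [IsNoetherianRing A] (X : ModuleCat.{u} A) [Module.Finite A X] :
    Nonempty (FGResolution X) := by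
  let S := { N : ModuleCat.{u} A // Module.Finite A N }
  have step : ∀ N : S, ∃ (K : S) (F : ModuleCat.{u} A) (i : K.1 ⟶ F) (p : F ⟶ N.1)
      (w : i ≫ p = 0), Module.Finite A F ∧ Projective F ∧ (ShortComplex.mk i p w).ShortExact := by
    rintro ⟨N, hN⟩
    obtain ⟨n, f, hf⟩ := Module.Finite.exists_fin' A N
    refine ⟨⟨ModuleCat.of A (LinearMap.ker f), inferInstanceAs (Module.Finite A (LinearMap.ker f))⟩,
      ModuleCat.of A (Fin n → A), ModuleCat.ofHom (LinearMap.ker f).subtype, ModuleCat.ofHom f, ?_,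
      inferInstanceAs (Module.Finite A (Fin n → A)), projective_of_projectiveModule _, ?_⟩
    · ext x
      exact x.2
    · exact LinearMap.shortExact_shortComplexKer hf
  choose K F i p w hF hP hS using step
  -- `T n` is the `n`-th iterated kernel; each differential is the cover of the next kernel followed
  -- by its inclusion.
  let T : ℕ → S := fun n => Nat.rec ⟨X, inferInstance⟩ (fun _ N => K N) n
  let d : ∀ n, F (T (n + 1)) ⟶ F (T n) := fun n => p (K (T n)) ≫ i (T n)
  have hd : ∀ n, d (n + 1) ≫ d n = 0 := fun n => by
    change (p (K (K (T n))) ≫ i (K (T n))) ≫ p (K (T n)) ≫ i (T n) = 0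
    rw [Category.assoc, reassoc_of% w (K (T n)), Limits.zero_comp, Limits.comp_zero]
  let c : ChainComplex (ModuleCat.{u} A) ℕ := ChainComplex.of (fun n => F (T n)) d hd
  have hw : ∀ N, (p (K N) ≫ i N) ≫ p N = 0 := fun N => by
    rw [Category.assoc, w, Limits.comp_zero]
  have hex0 : ∀ N, (ShortComplex.mk (p (K N) ≫ i N) (p N) (hw N)).Exact := fun N => by
    have := (hS (K N)).epi_g
    let α : ShortComplex.mk (p (K N) ≫ i N) (p N) (hw N) ⟶ ShortComplex.mk (i N) (p N) (w N) :=
      { τ₁ := p (K N)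
        τ₂ := 𝟙 _
        τ₃ := 𝟙 _
        comm₁₂ := (Category.comp_id _).symm
        comm₂₃ := (Category.id_comp _).trans (Category.comp_id _).symm }
    have : Epi α.τ₁ := this
    exact (ShortComplex.exact_iff_of_epi_of_isIso_of_mono α).mpr (hS N).exact
  have hex : ∀ n, (ShortComplex.mk (d (n + 1)) (d n) (hd n)).Exact := fun n => by
    let α : ShortComplex.mk (d (n + 1)) (p (T (n + 1))) (hw _) ⟶
        ShortComplex.mk (d (n + 1)) (d n) (hd n) :=
      { τ₁ := 𝟙 _
        τ₂ := 𝟙 _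
        τ₃ := i (T n)
        comm₁₂ := (Category.id_comp _).trans (Category.comp_id _).symm
        comm₂₃ := Category.id_comp _ }
    have : Mono α.τ₃ := (hS (T n)).mono_f
    exact (ShortComplex.exact_iff_of_epi_of_isIso_of_mono α).mp (hex0 _)
  have hc : ∀ n, c.d (n + 1) n = d n := fun n =>
    ChainComplex.of_d (fun n => F (T n)) d n
  exact ⟨{
    complex := c
    projective := fun n => hP (T n)
    finite := fun n => hF (T n)
    π := (ChainComplex.toSingle₀Equiv _ _).symm ⟨p (T 0), (hc 0).symm ▸ hw (T 0)⟩
    quasiIso := ⟨fun n => by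
      cases n
      · rw [ChainComplex.quasiIsoAt₀_iff, ShortComplex.quasiIso_iff_of_zeros']
        · refine (ShortComplex.exact_and_epi_g_iff_of_iso ?_).2
            ⟨hex0 (T 0), (hS _).epi_g⟩
          exact ShortComplex.isoMk (Iso.refl _) (Iso.refl _) (Iso.refl _)
            (by
              change 𝟙 _ ≫ d 0 = c.d 1 0 ≫ 𝟙 _
              rw [hc, Category.id_comp, Category.comp_id])
            (by
              simp only
              exact (Category.id_comp _).trans (Category.comp_id _).symm)
        all_goals rfl
      · rename_i n
        rw [quasiIsoAt_iff_exactAt']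
        · rw [HomologicalComplex.exactAt_iff' _ (n + 1 + 1) (n + 1) n (by simp) (by simp)]
          simp only [HomologicalComplex.sc', HomologicalComplex.shortComplexFunctor', hc]
          exact hex n
        · apply ChainComplex.exactAt_succ_single_obj⟩ }⟩

end Existence

/-! ### Short exact sequences obtained from cokernels and images. -/

section ShortExact

universe v v'

variable {C : Type v'} [Category.{v} C] [Abelian C]

theorem shortExact_cokernelDesc {X₁ X₂ X₃ X₄ : C} (f : X₁ ⟶ X₂) (g : X₂ ⟶ X₃) (h : X₃ ⟶ X₄)
    (wfg : f ≫ g = 0) (wgh : g ≫ h = 0) (hfg : (ShortComplex.mk f g wfg).Exact)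
    (hgh : (ShortComplex.mk g h wgh).Exact) [Epi h] :
    (ShortComplex.mk (Limits.cokernel.desc f g wfg) h (by
      rw [← cancel_epi (Limits.cokernel.π f), Limits.cokernel.π_desc_assoc, wgh,
        Limits.comp_zero])).ShortExact := by
  have hm : Mono (Limits.cokernel.desc f g wfg) :=
    (ShortComplex.exact_iff_mono_cokernel_desc (ShortComplex.mk f g wfg)).mp hfg
  let α : ShortComplex.mk g h wgh ⟶ ShortComplex.mk (Limits.cokernel.desc f g wfg) h (by
      rw [← cancel_epi (Limits.cokernel.π f), Limits.cokernel.π_desc_assoc, wgh,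
        Limits.comp_zero]) :=
    { τ₁ := Limits.cokernel.π f
      τ₂ := 𝟙 _
      τ₃ := 𝟙 _ }
  have : Epi α.τ₁ := inferInstanceAs (Epi (Limits.cokernel.π f))
  exact
    { exact := (ShortComplex.exact_iff_of_epi_of_isIso_of_mono α).mp hgh
      mono_f := hm
      epi_g := ‹_› }

theorem shortExact_kernel_image {X Y : C} (g : X ⟶ Y) :
    (ShortComplex.mk (Limits.kernel.ι g) (Abelian.factorThruImage g) (by
      rw [← cancel_mono (Abelian.image.ι g)]; simp)).ShortExact := by
  let α : ShortComplex.mk (Limits.kernel.ι g) (Abelian.factorThruImage g) (by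
      rw [← cancel_mono (Abelian.image.ι g)]; simp) ⟶
      ShortComplex.mk (Limits.kernel.ι g) g (Limits.kernel.condition g) :=
    { τ₁ := 𝟙 _
      τ₂ := 𝟙 _
      τ₃ := Abelian.image.ι g }
  exact
    { exact := (ShortComplex.exact_iff_of_epi_of_isIso_of_mono α).mpr
        (ShortComplex.exact_of_f_is_kernel _ (Limits.kernelIsKernel g))
      mono_f := inferInstanceAs (Mono (Limits.kernel.ι g))
      epi_g := inferInstanceAs (Epi (Abelian.factorThruImage g)) }

/-- As `e` is an epimorphism, `g` and `h` have the same image. This is applied with `e` the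
projection onto `Tr Ω^n M` and `h` the dual of a differential. -/
theorem shortExact_image_cokernel {X T Y : C} (e : X ⟶ T) [Epi e] (g : T ⟶ Y) (h : X ⟶ Y)
    (w : e ≫ g = h) :
    (ShortComplex.mk (Abelian.image.ι g) (Limits.cokernel.π h) (by
      rw [← cancel_epi (Abelian.factorThruImage g), ← cancel_epi e]
      simp [reassoc_of% w])).ShortExact := by
  let α : ShortComplex.mk h (Limits.cokernel.π h) (Limits.cokernel.condition h) ⟶
      ShortComplex.mk (Abelian.image.ι g) (Limits.cokernel.π h) (by
        rw [← cancel_epi (Abelian.factorThruImage g), ← cancel_epi e]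
        simp [reassoc_of% w]) :=
    { τ₁ := e ≫ Abelian.factorThruImage g
      τ₂ := 𝟙 _
      τ₃ := 𝟙 _
      comm₁₂ := by simp [w] }
  have : Epi α.τ₁ := epi_comp _ _
  exact
    { exact := (ShortComplex.exact_iff_of_epi_of_isIso_of_mono α).mp
        (ShortComplex.exact_of_g_is_cokernel _ (Limits.cokernelIsCokernel h))
      mono_f := inferInstanceAs (Mono (Abelian.image.ι g))
      epi_g := inferInstanceAs (Epi (Limits.cokernel.π h)) }

end ShortExact

/-! ### Syzygies as cokernels of the differentials. -/

namespace FGResolution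

variable {A : Type u} [Ring A] {X : ModuleCat.{u} A}

/-- The syzygy `Ω^k X` as the cokernel of `Q (k + 1) ⟶ Q k`. -/
noncomputable def coker (Q : FGResolution X) (k : ℕ) : ModuleCat.{u} A :=
  Limits.cokernel (Q.diff k)

/-- The projection `Q k ⟶ Ω^k X`. -/
noncomputable def cokerπ (Q : FGResolution X) (k : ℕ) : Q.obj k ⟶ Q.coker k :=
  Limits.cokernel.π (Q.diff k)

instance (Q : FGResolution X) (k : ℕ) : Epi (Q.cokerπ k) :=
  inferInstanceAs (Epi (Limits.cokernel.π (Q.diff k)))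

theorem diff_cokerπ (Q : FGResolution X) (k : ℕ) : Q.diff k ≫ Q.cokerπ k = 0 :=
  Limits.cokernel.condition _

/-- The morphism out of `Ω^k X` induced by a morphism out of `Q k`. -/
noncomputable def cokerDesc (Q : FGResolution X) (k : ℕ) {W : ModuleCat.{u} A} (g : Q.obj k ⟶ W)
    (hg : Q.diff k ≫ g = 0) : Q.coker k ⟶ W :=
  Limits.cokernel.desc _ g hg

theorem cokerπ_desc (Q : FGResolution X) (k : ℕ) {W : ModuleCat.{u} A} (g : Q.obj k ⟶ W)
    (hg : Q.diff k ≫ g = 0) : Q.cokerπ k ≫ Q.cokerDesc k g hg = g :=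
  Limits.cokernel.π_desc _ _ _

theorem exact_diff (Q : FGResolution X) (k : ℕ) :
    (ShortComplex.mk (Q.diff (k + 1)) (Q.diff k) (Q.diff_diff k)).Exact :=
  Q.toProjectiveResolution.exact_succ k

theorem exact_aug (Q : FGResolution X) :
    (ShortComplex.mk (Q.diff 0) Q.aug Q.diff_aug).Exact :=
  Q.toProjectiveResolution.exact₀

instance (Q : FGResolution X) : Epi Q.aug := inferInstanceAs (Epi (Q.π.f 0))

/-- The inclusion `Ω^(k + 1) X ⟶ Q k`. -/
noncomputable def cokerι (Q : FGResolution X) (k : ℕ) : Q.coker (k + 1) ⟶ Q.obj k :=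
  Q.cokerDesc (k + 1) (Q.diff k) (Q.diff_diff k)

theorem cokerπ_ι (Q : FGResolution X) (k : ℕ) : Q.cokerπ (k + 1) ≫ Q.cokerι k = Q.diff k :=
  Q.cokerπ_desc _ _ _

theorem cokerι_π (Q : FGResolution X) (k : ℕ) : Q.cokerι k ≫ Q.cokerπ k = 0 := by
  rw [← cancel_epi (Q.cokerπ (k + 1)), reassoc_of% cokerπ_ι, diff_cokerπ, Limits.comp_zero]

theorem cokerι_aug (Q : FGResolution X) : Q.cokerι 0 ≫ Q.aug = 0 := by
  rw [← cancel_epi (Q.cokerπ 1), reassoc_of% cokerπ_ι, diff_aug, Limits.comp_zero]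

/-- The short exact sequence `0 ⟶ Ω^(k + 1) X ⟶ Q k ⟶ Ω^k X ⟶ 0`. -/
noncomputable abbrev cokerSeq (Q : FGResolution X) (k : ℕ) : ShortComplex (ModuleCat.{u} A) :=
  ShortComplex.mk (Q.cokerι k) (Q.cokerπ k) (Q.cokerι_π k)

theorem cokerSeq_shortExact (Q : FGResolution X) (k : ℕ) : (Q.cokerSeq k).ShortExact :=
  shortExact_cokernelDesc _ _ _ _ (Q.diff_cokerπ k) (Q.exact_diff k)
    (ShortComplex.exact_of_g_is_cokernel (ShortComplex.mk (Q.diff k) (Q.cokerπ k) (Q.diff_cokerπ k))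
      (Limits.cokernelIsCokernel (Q.diff k)))

/-- The short exact sequence `0 ⟶ Ω^1 X ⟶ Q 0 ⟶ X ⟶ 0`. -/
noncomputable abbrev augSeq (Q : FGResolution X) : ShortComplex (ModuleCat.{u} A) :=
  ShortComplex.mk (Q.cokerι 0) Q.aug Q.cokerι_aug

theorem augSeq_shortExact (Q : FGResolution X) : Q.augSeq.ShortExact :=
  shortExact_cokernelDesc _ _ _ _ _ (Q.exact_diff 0) Q.exact_aug

/-- The comparison `Ω^0 X ⟶ X`. -/
noncomputable def cokerAug (Q : FGResolution X) : Q.coker 0 ⟶ X :=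
  Q.cokerDesc 0 Q.aug Q.diff_aug

theorem cokerπ_cokerAug (Q : FGResolution X) : Q.cokerπ 0 ≫ Q.cokerAug = Q.aug :=
  Q.cokerπ_desc _ _ _

instance (Q : FGResolution X) : IsIso Q.cokerAug := by
  have : Mono Q.cokerAug :=
    (ShortComplex.exact_iff_mono_cokernel_desc (ShortComplex.mk _ _ Q.diff_aug)).mp Q.exact_aug
  have : Epi Q.cokerAug := epi_of_epi_fac Q.cokerπ_cokerAug
  exact isIso_of_mono_of_epi _

end FGResolution

/-! ### The maps `alpha` and `beta` between syzygies of transposes. -/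

section Alpha

variable {R : Type u} [Ring R] {M : ModuleCat.{u} Rᵐᵒᵖ} {P : FGResolution M}

/-- The projection `P (n + 1) ^* ⟶ Tr Ω^n M`. -/
noncomputable def trSyzygyπ (P : FGResolution M) (n : ℕ) :
    dual Rᵐᵒᵖ R R (P.obj (n + 1)) ⟶ trSyzygy R R P n :=
  Limits.cokernel.π (dualMap R R (P.diff n))

instance (P : FGResolution M) (n : ℕ) : Epi (trSyzygyπ P n) :=
  inferInstanceAs (Epi (Limits.cokernel.π (dualMap R R (P.diff n))))

/-- The morphism out of `Tr Ω^n M` induced by a morphism out of `P (n + 1) ^*`. -/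
noncomputable def trSyzygyDesc (P : FGResolution M) (n : ℕ) {W : ModuleCat.{u} R}
    (g : dual Rᵐᵒᵖ R R (P.obj (n + 1)) ⟶ W) (hg : dualMap R R (P.diff n) ≫ g = 0) :
    trSyzygy R R P n ⟶ W :=
  Limits.cokernel.desc _ g hg

theorem trSyzygyπ_desc (P : FGResolution M) (n : ℕ) {W : ModuleCat.{u} R}
    (g : dual Rᵐᵒᵖ R R (P.obj (n + 1)) ⟶ W) (hg : dualMap R R (P.diff n) ≫ g = 0) :
    trSyzygyπ P n ≫ trSyzygyDesc P n g hg = g :=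
  Limits.cokernel.π_desc _ _ _

theorem trSyzygyπ_toDual (P : FGResolution M) (n : ℕ) :
    trSyzygyπ P n ≫ trSyzygyToDual P n = dualMap R R (P.diff (n + 1)) :=
  Limits.cokernel.π_desc _ _ _

theorem dualMap_diff_diff (P : FGResolution M) (n : ℕ) :
    dualMap R R (P.diff n) ≫ dualMap R R (P.diff (n + 1)) = 0 := by
  rw [← dualMap_comp, P.diff_diff, dualMap_zero]

theorem projective_dual_obj (P : FGResolution M) (n : ℕ) :
    Projective (dual Rᵐᵒᵖ R R (P.obj n)) := by
  have := P.finite n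
  have : Module.Projective Rᵐᵒᵖ (P.obj n) :=
    (IsProjective.iff_projective (P.obj n)).mpr (P.projective n)
  have := projective_dual (A := Rᵐᵒᵖ) R R (P.obj n)
  exact projective_of_projectiveModule _

variable {n : ℕ} {Q : TrResolution P n}

theorem PsiLift.map_aug (F : PsiLift P n Q) (h : 0 + (n + 1) = n + 1) :
    F.map 0 (n + 1) h ≫ Q.aug = trSyzygyπ P n :=
  F.comm_aug

/-- The map `Tr M ⟶ Ω^n Tr Ω^n M` induced by a chain map that defines `ψ_M^n`. -/
noncomputable def PsiLift.alpha (F : PsiLift P n Q) : trSyzygy R R P 0 ⟶ Q.coker n :=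
  trSyzygyDesc P 0 (F.map n 1 rfl ≫ Q.cokerπ n) (by
    rw [← Category.assoc, ← F.comm n 0 rfl, Category.assoc, Q.diff_cokerπ, Limits.comp_zero])

theorem PsiLift.trSyzygyπ_alpha (F : PsiLift P n Q) :
    trSyzygyπ P 0 ≫ F.alpha = F.map n 1 rfl ≫ Q.cokerπ n :=
  trSyzygyπ_desc _ _ _ _

theorem PsiLift.alpha_cokerAug {Q : TrResolution P 0} (F : PsiLift P 0 Q) :
    F.alpha ≫ Q.cokerAug = 𝟙 _ := by
  rw [← cancel_epi (trSyzygyπ P 0), reassoc_of% F.trSyzygyπ_alpha, Q.cokerπ_cokerAug,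
    Category.comp_id]
  exact F.comm_aug

/-- The start of the induction on the index: for `n = 0` the chain map lies over the identity of `Tr
M`, so `alpha` is inverse to the canonical isomorphism `cokerAug`. -/
theorem PsiLift.isIso_alpha {Q : TrResolution P 0} (F : PsiLift P 0 Q) : IsIso F.alpha := by
  have : IsIso (F.alpha ≫ Q.cokerAug) := by
    rw [F.alpha_cokerAug]
    infer_instance
  exact IsIso.of_isIso_comp_right _ Q.cokerAug

/-- Two chain maps over the identity of `Tr Ω^n M` are homotopic. -/
theorem PsiLift.exists_homotopy (F F' : PsiLift P n Q) : ∀ (k m : ℕ) (h : k + (m + 1) = n + 1),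
    ∃ t : dual Rᵐᵒᵖ R R (P.obj (m + 1)) ⟶ Q.obj (k + 1),
      dualMap R R (P.diff m) ≫ t ≫ Q.diff k =
        dualMap R R (P.diff m) ≫ (F.map k (m + 1) h - F'.map k (m + 1) h)
  | 0, m, h => by
    obtain rfl : m = n := by omega
    have := projective_dual_obj P (m + 1)
    have h0 : (F.map 0 (m + 1) h - F'.map 0 (m + 1) h) ≫ Q.aug = 0 := by
      rw [Preadditive.sub_comp, F.map_aug, F'.map_aug, sub_self]
    exact ⟨Q.exact_aug.liftFromProjective _ h0,
      congrArg _ (Q.exact_aug.liftFromProjective_comp _ h0)⟩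
  -- The homotopy identity is stated only after precomposition with the incoming dual differential.
  -- This kills the contribution of the previous homotopy, so the recursion needs to carry just one
  -- map `t`.
  | k + 1, m, h => by
    obtain ⟨t, ht⟩ := exists_homotopy F F' k (m + 1) (by omega)
    have := projective_dual_obj P (m + 1)
    have h0 : (F.map (k + 1) (m + 1) h - F'.map (k + 1) (m + 1) h -
        dualMap R R (P.diff (m + 1)) ≫ t) ≫ Q.diff k = 0 := by
      rw [Preadditive.sub_comp, Preadditive.sub_comp, F.comm, F'.comm, Category.assoc, ht,
        Preadditive.comp_sub, sub_self]
    refine ⟨(Q.exact_diff k).liftFromProjective _ h0, ?_⟩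
    have h1 := (Q.exact_diff k).liftFromProjective_comp _ h0
    dsimp only at h1
    rw [h1, Preadditive.comp_sub, ← Category.assoc, dualMap_diff_diff, Limits.zero_comp, sub_zero]

/-- The difference of the two components on `P 1^*` is a map through `Q.diff (n + 1)` plus `dualMap
R R (P.diff 1) ≫ t`. The first part vanishes in `Ω^(n+1) Tr Ω^(n+1) M`; the second factors through
the projective module `P 2^*`. -/
theorem PsiLift.stablyEq_alpha {n : ℕ} {Q : TrResolution P (n + 1)} (F F' : PsiLift P (n + 1) Q) :
    StablyEq F.alpha F'.alpha := by
  obtain ⟨t, ht⟩ := F.exists_homotopy F' n 1 rfl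
  have := projective_dual_obj P 1
  have h0 : (F.map (n + 1) 1 rfl - F'.map (n + 1) 1 rfl -
      dualMap R R (P.diff 1) ≫ t) ≫ Q.diff n = 0 := by
    rw [Preadditive.sub_comp, Preadditive.sub_comp, F.comm, F'.comm, Category.assoc, ht,
      Preadditive.comp_sub, sub_self]
  let t' := (Q.exact_diff n).liftFromProjective _ h0
  have h1 : t' ≫ Q.diff (n + 1) = _ := (Q.exact_diff n).liftFromProjective_comp _ h0
  refine ⟨_, projective_dual_obj P 2, trSyzygyToDual P 0, t ≫ Q.cokerπ (n + 1), ?_⟩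
  rw [← cancel_epi (trSyzygyπ P 0), Preadditive.comp_add, F.trSyzygyπ_alpha, F'.trSyzygyπ_alpha,
    reassoc_of% trSyzygyπ_toDual, ← sub_eq_iff_eq_add', ← sub_eq_zero, ← Preadditive.sub_comp,
    ← Category.assoc (dualMap R R (P.diff 1)), ← Preadditive.sub_comp, ← h1, Category.assoc,
    Q.diff_cokerπ, Limits.comp_zero]

variable {Q' : TrResolution P (n + 1)}

/-- The composition of a chain map that defines `ψ_M^n` and one that defines `ψ_M^{n+1,n}`. -/
noncomputable def PsiLift.comp (F : PsiLift P n Q) (G : PsiStepLift P n Q Q') :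
    PsiLift P (n + 1) Q' where
  map
    | 0, m, h => (show n + 2 = m by omega) ▸ G.base
    | k + 1, m, h => F.map k m (by omega) ≫ G.map k
  comm
    | 0, m, h => by
      obtain rfl : m = n + 1 := by omega
      change (F.map 0 (n + 1) _ ≫ G.map 0) ≫ Q'.diff 0 = dualMap R R (P.diff (n + 1)) ≫ G.base
      rw [Category.assoc, G.comm_zero, reassoc_of% F.comm_aug]
      exact (reassoc_of% trSyzygyπ_toDual P n) _
    | k + 1, m, h => by
      change (F.map (k + 1) m _ ≫ G.map (k + 1)) ≫ Q'.diff (k + 1) =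
        dualMap R R (P.diff m) ≫ F.map k (m + 1) _ ≫ G.map k
      rw [Category.assoc, G.comm, ← Category.assoc, F.comm, Category.assoc]
  comm_aug := G.base_aug

/-- The map `Ω^k Tr Ω^n M ⟶ Ω^(k + 1) Tr Ω^(n + 1) M`. -/
noncomputable def PsiStepLift.beta (G : PsiStepLift P n Q Q') (k : ℕ) :
    Q.coker k ⟶ Q'.coker (k + 1) :=
  Q.cokerDesc k (G.map k ≫ Q'.cokerπ (k + 1)) (by
    rw [← Category.assoc, ← G.comm, Category.assoc, Q'.diff_cokerπ, Limits.comp_zero])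

theorem PsiStepLift.cokerπ_beta (G : PsiStepLift P n Q Q') (k : ℕ) :
    Q.cokerπ k ≫ G.beta k = G.map k ≫ Q'.cokerπ (k + 1) :=
  Q.cokerπ_desc _ _ _

theorem PsiLift.alpha_comp (F : PsiLift P n Q) (G : PsiStepLift P n Q Q') :
    (F.comp G).alpha = F.alpha ≫ G.beta n := by
  rw [← cancel_epi (trSyzygyπ P 0), trSyzygyπ_alpha, reassoc_of% F.trSyzygyπ_alpha, G.cokerπ_beta]
  exact Category.assoc _ _ _

/-- `F.comp G` and `F'` are chain maps over the same identity, so their `alpha` maps are stably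
equal. This is the link between `ψ^{n+1}`, `ψ^n` and `ψ^{n+1,n}`. -/
theorem PsiLift.stablyEq_alpha_comp_beta (F : PsiLift P n Q) (F' : PsiLift P (n + 1) Q')
    (G : PsiStepLift P n Q Q') : StablyEq F'.alpha (F.alpha ≫ G.beta n) := by
  rw [← alpha_comp]
  exact stablyEq_alpha _ _

end Alpha

/-! ### Reflexivity of finitely generated projective left modules. -/

section LeftBidual

variable {R : Type u} [Ring R]

/-- The canonical map `P ⟶ P^{**}` for a left `R`-module `P`. -/
def leftBidualMap (P : ModuleCat.{u} R) :
    P →ₗ[R] dual Rᵐᵒᵖ R R (dual R Rᵐᵒᵖ R P) where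
  toFun x :=
    { toFun := fun φ => (φ : P →ₗ[R] R) x
      map_add' := fun _ _ => rfl
      map_smul' := fun _ _ => rfl }
  map_add' x y := LinearMap.ext fun φ => map_add (φ : P →ₗ[R] R) x y
  map_smul' a x := LinearMap.ext fun φ => map_smul (φ : P →ₗ[R] R) a x

/-- A dual basis `e`, `c` determines each `x` by the values `c i x`, and each form `q` on the dual
by the values `q (c i)`, which are the coordinates of its preimage. -/
theorem leftBidualMap_bijective (P : ModuleCat.{u} R) [Module.Finite R P]
    [Module.Projective R P] : Function.Bijective (leftBidualMap P) := by
  obtain ⟨n, f, g, -, -, hfg⟩ := Module.Finite.exists_comp_eq_id_of_projective R P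
  let e : Fin n → P := fun i => f (Pi.single i 1)
  let c : Fin n → (P →ₗ[R] R) := fun i => LinearMap.proj i ∘ₗ g
  have hx : ∀ x : P, x = ∑ i, c i x • e i := by
    intro x
    have h1 : f (g x) = x := LinearMap.congr_fun hfg x
    have h2 : g x = ∑ i, g x i • (Pi.single i 1 : Fin n → R) := by
      ext k
      simp [Finset.sum_apply, Pi.single_apply]
    conv_lhs => rw [← h1, h2]
    simp only [map_sum, map_smul, c, e, LinearMap.comp_apply, LinearMap.proj_apply]
  constructor
  · intro x y hxy
    have h : ∀ i, c i x = c i y := fun i => LinearMap.congr_fun hxy (c i)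
    rw [hx x, hx y]
    simp only [h]
  · intro q
    refine ⟨∑ i, (q : (P →ₗ[R] R) →ₗ[Rᵐᵒᵖ] R) (c i) • e i, ?_⟩
    apply LinearMap.ext
    intro φ
    have hφ : φ = ∑ i, MulOpposite.op (φ (e i) : R) • c i := by
      apply LinearMap.ext
      intro y
      conv_lhs => rw [hx y]
      simp [LinearMap.sum_apply]
    change (φ : P →ₗ[R] R) (∑ i, (q : (P →ₗ[R] R) →ₗ[Rᵐᵒᵖ] R) (c i) • e i) =
      (q : (P →ₗ[R] R) →ₗ[Rᵐᵒᵖ] R) φ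
    conv_rhs => rw [hφ]
    simp

/-- `leftBidualMap` as a morphism. -/
def leftBidual (P : ModuleCat.{u} R) : P ⟶ dual Rᵐᵒᵖ R R (dual R Rᵐᵒᵖ R P) :=
  ModuleCat.ofHom (leftBidualMap P)

theorem leftBidual_naturality {P P' : ModuleCat.{u} R} (f : P ⟶ P') :
    f ≫ leftBidual P' = leftBidual P ≫ dualMap R R (dualMap Rᵐᵒᵖ R f) := rfl

theorem isIso_leftBidual (P : ModuleCat.{u} R) [Module.Finite R P] [Module.Projective R P] :
    IsIso (leftBidual P) :=
  (LinearEquiv.ofBijective (leftBidualMap P) (leftBidualMap_bijective P)).toModuleIso.isIso_hom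

theorem FGResolution.isIso_leftBidual {X : ModuleCat.{u} R} (Q : FGResolution X) (k : ℕ) :
    IsIso (leftBidual (Q.obj k)) := by
  have := Q.finite k
  have : Module.Projective R (Q.obj k) :=
    (IsProjective.iff_projective (Q.obj k)).mpr (Q.projective k)
  exact StableModule.isIso_leftBidual _

end LeftBidual

/-! ### Identification of the transposes of the natural maps with `alpha` and `beta`. -/

section Transposes

variable {R : Type u} [Ring R] {X : ModuleCat.{u} R}

variable (R) in
/-- The ring `R` as a right module over itself. -/
def opEquivRight : R ≃ₗ[Rᵐᵒᵖ] Rᵐᵒᵖ :=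
  { MulOpposite.opAddEquiv with
    map_smul' := fun _ _ => rfl }

instance : Module.Finite Rᵐᵒᵖ R := Module.Finite.equiv (opEquivRight R).symm

instance : Module.Projective Rᵐᵒᵖ R := Module.Projective.of_equiv (opEquivRight R).symm

theorem FGResolution.finite_leftDual (Q : FGResolution X) (k : ℕ) :
    Module.Finite Rᵐᵒᵖ (dual R Rᵐᵒᵖ R (Q.obj k)) := by
  have := Q.finite k
  have : Module.Projective R (Q.obj k) :=
    (IsProjective.iff_projective (Q.obj k)).mpr (Q.projective k)
  exact finite_dual (A := R) Rᵐᵒᵖ R _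

theorem FGResolution.projective_leftDual (Q : FGResolution X) (k : ℕ) :
    Projective (dual R Rᵐᵒᵖ R (Q.obj k)) := by
  have := Q.finite k
  have : Module.Projective R (Q.obj k) :=
    (IsProjective.iff_projective (Q.obj k)).mpr (Q.projective k)
  have := projective_dual (A := R) Rᵐᵒᵖ R (Q.obj k)
  exact projective_of_projectiveModule _

/-- The presentation `Q n ^* ⟶ Q (n + 1) ^* ⟶ Tr Ω^n X ⟶ 0`. -/
noncomputable def FGResolution.trPresentation (Q : FGResolution X) (n : ℕ) :
    Presentation (trSyzygy Rᵐᵒᵖ R Q n) where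
  P₁ := dual R Rᵐᵒᵖ R (Q.obj n)
  P₀ := dual R Rᵐᵒᵖ R (Q.obj (n + 1))
  d := dualMap Rᵐᵒᵖ R (Q.diff n)
  ε := Limits.cokernel.π (dualMap Rᵐᵒᵖ R (Q.diff n))
  w := Limits.cokernel.condition _
  exact := ShortComplex.exact_of_g_is_cokernel _ (Limits.cokernelIsCokernel _)
  epi := inferInstanceAs (Epi (Limits.cokernel.π (dualMap Rᵐᵒᵖ R (Q.diff n))))
  projective₁ := Q.projective_leftDual n
  projective₀ := Q.projective_leftDual (n + 1)
  finite₁ := Q.finite_leftDual n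

theorem FGResolution.finite_trSyzygy (Q : FGResolution X) (n : ℕ) :
    Module.Finite Rᵐᵒᵖ (trSyzygy Rᵐᵒᵖ R Q n) := by
  have := Q.finite_leftDual (n + 1)
  exact Module.Finite.of_surjective (Limits.cokernel.π (dualMap Rᵐᵒᵖ R (Q.diff n))).hom
    ((ModuleCat.epi_iff_surjective _).mp inferInstance)

/-- The isomorphism `Ω^n X ⟶ Tr Tr Ω^n X` for the canonical presentation of `Tr Ω^n X`. -/
noncomputable def FGResolution.cokerToTr (Q : FGResolution X) (n : ℕ) :
    Q.coker n ⟶ (Q.trPresentation n).tr R R :=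
  Limits.cokernel.map (Q.diff n) (dualMap R R (dualMap Rᵐᵒᵖ R (Q.diff n)))
    (leftBidual (Q.obj (n + 1))) (leftBidual (Q.obj n)) (leftBidual_naturality _)

theorem FGResolution.cokerπ_toTr (Q : FGResolution X) (n : ℕ) :
    Q.cokerπ n ≫ Q.cokerToTr n = leftBidual (Q.obj n) ≫ (Q.trPresentation n).trπ R R :=
  Limits.cokernel.π_desc _ _ _

instance (Q : FGResolution X) (n : ℕ) : IsIso (Q.cokerToTr n) := by
  have := Q.isIso_leftBidual n
  have := Q.isIso_leftBidual (n + 1)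
  exact (Limits.cokernel.mapIso (Q.diff n) (dualMap R R (dualMap Rᵐᵒᵖ R (Q.diff n)))
    (asIso (leftBidual (Q.obj (n + 1)))) (asIso (leftBidual (Q.obj n)))
    (leftBidual_naturality _)).isIso_hom

variable {M : ModuleCat.{u} Rᵐᵒᵖ} {P : FGResolution M} {n : ℕ} {Q : TrResolution P n}
  {Q' : TrResolution P (n + 1)}

/-- The lift of `ψ_M^n` to presentations. -/
noncomputable def PsiLift.presentationHom (F : PsiLift P n Q) :
    (Q.trPresentation n).Hom P.presentation (psi P n Q F) where
  f₁ := dualMap Rᵐᵒᵖ R (F.map n 1 rfl) ≫ (bidualIso P 1).inv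
  f₀ := dualMap Rᵐᵒᵖ R (F.map (n + 1) 0 rfl) ≫ (bidualIso P 0).inv
  comm := by
    change (_ ≫ _) ≫ P.diff 0 = dualMap Rᵐᵒᵖ R (Q.diff n) ≫ _
    rw [Category.assoc, ← bidualIso_naturality, ← Category.assoc, ← dualMap_comp,
      ← F.comm n 0 rfl, dualMap_comp, Category.assoc]
    rfl
  comm_ε := (Category.assoc _ _ _).trans (Limits.cokernel.π_desc _ _ _).symm

/-- Evaluation is symmetric: `φ` at the element of `P i` that represents a form on `(P i)^*` is that
form at `φ`. Here the form is `q ∘ f`, so both sides evaluate to `q (f φ)`. -/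
theorem dualMap_bidualIso_inv {X : ModuleCat.{u} R} (i : ℕ) (f : dual Rᵐᵒᵖ R R (P.obj i) ⟶ X) :
    dualMap R R (dualMap Rᵐᵒᵖ R f ≫ (bidualIso P i).inv) = f ≫ leftBidual X := by
  ext φ q
  have h := ConcreteCategory.congr_hom (bidualIso P i).inv_hom_id (dualMap Rᵐᵒᵖ R f q)
  exact LinearMap.congr_fun h φ

/-- Up to the isomorphism `Ω^n X ≅ Tr Tr Ω^n X` for `X = Tr Ω^n M`, the transpose of `ψ^n` is
`alpha`. -/
theorem PsiLift.alpha_cokerToTr (F : PsiLift P n Q) :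
    F.alpha ≫ Q.cokerToTr n = F.presentationHom.tr R R := by
  refine (cancel_epi (trSyzygyπ P 0)).mp (((reassoc_of% F.trSyzygyπ_alpha) _).trans ?_)
  rw [Q.cokerπ_toTr]
  refine (Category.assoc _ _ _).symm.trans ?_
  rw [← dualMap_bidualIso_inv]
  exact (Presentation.trπ_tr R R F.presentationHom).symm

/-- The lift of `ψ_M^{n+1,n}` to presentations. -/
noncomputable def PsiStepLift.presentationHom (G : PsiStepLift P n Q Q') :
    (Q'.trPresentation (n + 1)).Hom (Q.trPresentation n) (psiStep P n Q Q' G) where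
  f₁ := dualMap Rᵐᵒᵖ R (G.map n)
  f₀ := dualMap Rᵐᵒᵖ R (G.map (n + 1))
  comm := by
    change dualMap Rᵐᵒᵖ R (G.map n) ≫ dualMap Rᵐᵒᵖ R (Q.diff n) =
      dualMap Rᵐᵒᵖ R (Q'.diff (n + 1)) ≫ dualMap Rᵐᵒᵖ R (G.map (n + 1))
    rw [← dualMap_comp, ← dualMap_comp, G.comm]
  comm_ε := (Limits.cokernel.π_desc _ _ _).symm

theorem PsiStepLift.beta_cokerToTr (G : PsiStepLift P n Q Q') :
    G.beta n ≫ Q'.cokerToTr (n + 1) = Q.cokerToTr n ≫ G.presentationHom.tr R R := by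
  rw [← cancel_epi (Q.cokerπ n), reassoc_of% G.cokerπ_beta, Q'.cokerπ_toTr,
    reassoc_of% Q.cokerπ_toTr]
  refine (Category.assoc _ _ _).symm.trans ?_
  rw [leftBidual_naturality]
  refine (Category.assoc _ _ _).trans ?_
  exact congrArg (leftBidual (Q.obj n) ≫ ·) (Presentation.trπ_tr R R G.presentationHom).symm

/-- `ConditionT` quantifies over all resolutions of `X` and `Y`; the nonemptiness hypotheses keep it
from being vacuous. -/
theorem conditionT_iff {A B D : Type u} [Ring A] [Ring B] [AddCommGroup D] [Module A D] [Module B D]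
    [SMulCommClass A B D] [Module.Projective B D] {X Y : ModuleCat.{u} A}
    (hX : Nonempty (FGResolution X)) (hY : Nonempty (FGResolution Y))
    {p : Presentation X} {q : Presentation Y} {f : X ⟶ Y} (a : p.Hom q f) (j : ℕ) :
    ConditionT B D j f ↔ ExtCondition (ModuleCat.of B D) (a.tr B D) 0 j := by
  obtain ⟨P⟩ := hX
  obtain ⟨Q⟩ := hY
  exact ⟨fun h => (extCondition_transposeMap_iff B D a P Q j).mp (h P Q),
    fun h P Q => (extCondition_transposeMap_iff B D a P Q j).mpr h⟩

theorem conditionT_psi_iff [IsNoetherianRing Rᵐᵒᵖ] (F : PsiLift P n Q) (j : ℕ) :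
    ConditionT R R j (psi P n Q F) ↔ ExtCondition (ModuleCat.of R R) F.alpha 0 j := by
  have := Q.finite_trSyzygy n
  rw [conditionT_iff (FGResolution.nonempty _) ⟨P⟩ F.presentationHom j, ← F.alpha_cokerToTr]
  refine (extCondition_of_stable_square _ (a := 𝟙 _) (b := Q.cokerToTr n) 0 j
    (.of_eq (Category.id_comp _)) (fun m _ => extPre_bijective_of_isIso _ _ m)
    (fun m _ => extPre_bijective_of_isIso _ _ m)).symm

theorem conditionT_psiStep_iff [IsNoetherianRing Rᵐᵒᵖ] (G : PsiStepLift P n Q Q') (j : ℕ) :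
    ConditionT R R j (psiStep P n Q Q' G) ↔ ExtCondition (ModuleCat.of R R) (G.beta n) 0 j := by
  have := Q.finite_trSyzygy n
  have := Q'.finite_trSyzygy (n + 1)
  rw [conditionT_iff (FGResolution.nonempty _) (FGResolution.nonempty _) G.presentationHom j]
  exact (extCondition_of_stable_square _ (a := Q.cokerToTr n) (b := Q'.cokerToTr (n + 1)) 0 j
    (.of_eq G.beta_cokerToTr.symm) (fun m _ => extPre_bijective_of_isIso _ _ m)
    (fun m _ => extPre_bijective_of_isIso _ _ m)).symm

end Transposes

/-! ### Dimension shifting from `beta` to the map onto the image. -/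

section DimensionShift

variable {R : Type u} [Ring R] {M : ModuleCat.{u} Rᵐᵒᵖ} {P : FGResolution M} {n : ℕ}
  {Q : TrResolution P n} {Q' : TrResolution P (n + 1)}

instance {A : Type u} [Ring A] {X : ModuleCat.{u} A} (Q : FGResolution X) (k : ℕ) :
    Projective (Q.cokerSeq k).X₂ := Q.projective k

instance {A : Type u} [Ring A] {X : ModuleCat.{u} A} (Q : FGResolution X) :
    Projective Q.augSeq.X₂ := Q.projective 0

/-- The morphism between the sequences `0 ⟶ Ω^(k + 1) ⟶ Q k ⟶ Ω^k ⟶ 0` induced by a chain map. -/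
noncomputable def PsiStepLift.seqHom (G : PsiStepLift P n Q Q') (k : ℕ) :
    Q.cokerSeq k ⟶ Q'.cokerSeq (k + 1) where
  τ₁ := G.beta (k + 1)
  τ₂ := G.map k
  τ₃ := G.beta k
  comm₁₂ := by
    rw [← cancel_epi (Q.cokerπ (k + 1)), reassoc_of% G.cokerπ_beta, Q'.cokerπ_ι,
      reassoc_of% Q.cokerπ_ι, G.comm]
  comm₂₃ := (G.cokerπ_beta k).symm

/-- Each passage to a syzygy is traded for one Ext degree. The shift `s` stays free because the
recursion raises it. -/
theorem PsiStepLift.extCondition_beta_iff (G : PsiStepLift P n Q Q') (Y : ModuleCat.{u} R)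
    (s j : ℕ) : ∀ k : ℕ, ExtCondition Y (G.beta k) s j ↔ ExtCondition Y (G.beta 0) (s + k) j
  | 0 => Iff.rfl
  | k + 1 => by
    refine (extCondition_shift Y (Q.cokerSeq_shortExact k) (Q'.cokerSeq_shortExact (k + 1))
      (G.seqHom k) s j).symm.trans ((extCondition_beta_iff G Y (s + 1) j k).trans ?_)
    rw [show s + 1 + k = s + (k + 1) by omega]

theorem imageι_trSyzygyπ (P : FGResolution M) (n : ℕ) :
    Abelian.image.ι (trSyzygyToDual P n) ≫ trSyzygyπ P (n + 1) = 0 := by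
  rw [← cancel_epi (Abelian.factorThruImage (trSyzygyToDual P n)), ← cancel_epi (trSyzygyπ P n),
    reassoc_of% Abelian.image.fac (trSyzygyToDual P n), reassoc_of% trSyzygyπ_toDual,
    Limits.comp_zero, Limits.comp_zero]
  exact Limits.cokernel.condition _

/-- The short exact sequence `0 ⟶ Im ⟶ P (n + 2) ^* ⟶ Tr Ω^(n + 1) M ⟶ 0`, where `Im` is the image
of `Tr Ω^n M ⟶ P (n + 2) ^*`. -/
noncomputable abbrev imageSeq (P : FGResolution M) (n : ℕ) : ShortComplex (ModuleCat.{u} R) :=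
  ShortComplex.mk (Abelian.image.ι (trSyzygyToDual P n)) (trSyzygyπ P (n + 1))
    (imageι_trSyzygyπ P n)

theorem imageSeq_shortExact (P : FGResolution M) (n : ℕ) : (imageSeq P n).ShortExact :=
  shortExact_image_cokernel (trSyzygyπ P n) _ _ (trSyzygyπ_toDual P n)

instance (P : FGResolution M) (n : ℕ) : Projective (imageSeq P n).X₂ :=
  projective_dual_obj P (n + 2)

theorem PsiStepLift.imageι_base_aug (G : PsiStepLift P n Q Q') :
    (Abelian.image.ι (trSyzygyToDual P n) ≫ G.base) ≫ Q'.aug = 0 := by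
  rw [Category.assoc, G.base_aug]
  exact imageι_trSyzygyπ P n

/-- The comparison between the two first syzygies of `Tr Ω^(n + 1) M`. -/
noncomputable def PsiStepLift.omega (G : PsiStepLift P n Q Q') :
    Abelian.image (trSyzygyToDual P n) ⟶ Q'.coker 1 :=
  haveI : Mono Q'.augSeq.f := Q'.augSeq_shortExact.mono_f
  Q'.augSeq_shortExact.exact.lift _ G.imageι_base_aug

theorem PsiStepLift.omega_ι (G : PsiStepLift P n Q Q') :
    G.omega ≫ Q'.cokerι 0 = Abelian.image.ι (trSyzygyToDual P n) ≫ G.base :=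
  haveI : Mono Q'.augSeq.f := Q'.augSeq_shortExact.mono_f
  Q'.augSeq_shortExact.exact.lift_f _ G.imageι_base_aug

/-- Source and target of `omega` are first syzygies of `Tr Ω^(n+1) M`, and `omega` is induced by the
identity of that module. -/
theorem PsiStepLift.extPre_omega_bijective (G : PsiStepLift P n Q Q') (Y : ModuleCat.{u} R) {m : ℕ}
    (hm : 1 ≤ m) : Function.Bijective (extPre Y G.omega m) := by
  let f : imageSeq P n ⟶ Q'.augSeq :=
    { τ₁ := G.omega
      τ₂ := G.base
      τ₃ := 𝟙 _
      comm₁₂ := G.omega_ι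
      comm₂₃ := G.base_aug.trans (Category.comp_id _).symm }
  have : IsIso f.τ₃ := inferInstanceAs (IsIso (𝟙 _))
  exact extPre_bijective_of_shift Y (imageSeq_shortExact P n) Q'.augSeq_shortExact f hm

theorem PsiStepLift.beta_zero (G : PsiStepLift P n Q Q') :
    Q.cokerAug ≫ Abelian.factorThruImage (trSyzygyToDual P n) ≫ G.omega = G.beta 0 := by
  have : Mono (Q'.cokerι 0) := Q'.augSeq_shortExact.mono_f
  rw [← cancel_mono (Q'.cokerι 0), ← cancel_epi (Q.cokerπ 0), Category.assoc, Category.assoc,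
    G.omega_ι, reassoc_of% Abelian.image.fac (trSyzygyToDual P n), reassoc_of% Q.cokerπ_cokerAug,
    reassoc_of% G.cokerπ_beta, Q'.cokerπ_ι,
    G.comm_zero]

/-- Shifting down to `beta 0` costs `n` degrees. By `beta_zero`, `beta 0` is the projection onto the
image, up to the isomorphism `cokerAug` and the map `omega`, and both are bijective on positive Ext.
-/
theorem PsiStepLift.extCondition_beta (G : PsiStepLift P n Q Q') (Y : ModuleCat.{u} R) (j : ℕ) :
    ExtCondition Y (G.beta n) 0 j ↔
      ExtCondition Y (Abelian.factorThruImage (trSyzygyToDual P n)) n j := by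
  rw [G.extCondition_beta_iff, show 0 + n = n from zero_add n]
  exact (extCondition_of_stable_square Y (a := Q.cokerAug) (b := 𝟙 _) n j
      (.of_eq (G.beta_zero.trans (Category.comp_id _).symm))
      (fun m _ => extPre_bijective_of_isIso _ _ m)
      (fun m _ => extPre_bijective_of_isIso _ _ m)).trans
    (extCondition_of_stable_square Y (a := 𝟙 _) (b := G.omega) n j
      (.of_eq (Category.id_comp _)) (fun m _ => extPre_bijective_of_isIso _ _ m)
      (fun m hm => G.extPre_omega_bijective Y hm)).symm

end DimensionShift

/-! ### Grade as vanishing of Ext. -/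

section Grade

variable {B D : Type u} [Ring B] [AddCommGroup D] [Module B D]

theorem le_moduleGrade_iff (k : ℕ) (N : ModuleCat.{u} B) :
    (k : ℕ∞) ≤ moduleGrade B D N ↔
      ∀ m < k, Subsingleton (Ext N (ModuleCat.of B D) m) := by
  simp only [moduleGrade, le_iInf_iff, Nat.cast_le]
  refine forall_congr' fun m => ?_
  rw [← not_nontrivial_iff_subsingleton, ← not_le]
  tauto

theorem subsingleton_ext_congr {N N' : ModuleCat.{u} B} (e : N ≅ N') (Y : ModuleCat.{u} B) (m : ℕ) :
    Subsingleton (Ext N Y m) ↔ Subsingleton (Ext N' Y m) :=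
  (Equiv.ofBijective _ (extPre_bijective_of_isIso Y e.inv m)).subsingleton_congr

end Grade

/-! ### `Ext^(n+1)(M, R)` inside `Tr Ω^n M`; the automatic degrees; torsionfree syzygies. -/

section ExtKernel

variable {R : Type u} [Ring R] {M : ModuleCat.{u} Rᵐᵒᵖ}

theorem extObj_smul (X : ModuleCat.{u} Rᵐᵒᵖ) (i : ℕ) (r : R)
    (e : Ext X (ModuleCat.of Rᵐᵒᵖ R) i) :
    (show Ext X (ModuleCat.of Rᵐᵒᵖ R) i from r • (show extObj R R X i from e)) =
      e.comp (Ext.mk₀ (mulEnd (A := Rᵐᵒᵖ) R R r)) (add_zero i) := rfl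

/-- The class in `Ext^(n + 1)(M, R)` of a cocycle. -/
noncomputable def cocycleExt (P : FGResolution M) (n : ℕ)
    (f : LinearMap.ker (dualMap R R (P.diff (n + 1))).hom) :
    Ext M (ModuleCat.of Rᵐᵒᵖ R) (n + 1) :=
  P.extMk (Y := ModuleCat.of Rᵐᵒᵖ R) (ModuleCat.ofHom (f : P.obj (n + 1) →ₗ[Rᵐᵒᵖ] R))
    (n + 2) rfl (ModuleCat.hom_ext f.2)

theorem cocycleExt_smul (P : FGResolution M) (n : ℕ) (r : R)
    (f : LinearMap.ker (dualMap R R (P.diff (n + 1))).hom) :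
    cocycleExt P n (r • f) =
      (cocycleExt P n f).comp (Ext.mk₀ (mulEnd (A := Rᵐᵒᵖ) R R r)) (add_zero _) := by
  rw [cocycleExt, cocycleExt, ProjectiveResolution.extMk_comp_mk₀]
  congr 1

theorem cocycleExt_add (P : FGResolution M) (n : ℕ)
    (f g : LinearMap.ker (dualMap R R (P.diff (n + 1))).hom) :
    cocycleExt P n (f + g) = cocycleExt P n f + cocycleExt P n g := by
  rw [cocycleExt, cocycleExt, cocycleExt, ProjectiveResolution.add_extMk]
  congr 1

/-- The class in `Ext^(n + 1)(M, R)` of a cocycle, as a linear map. -/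
noncomputable def cocycleClass (P : FGResolution M) (n : ℕ) :
    LinearMap.ker (dualMap R R (P.diff (n + 1))).hom →ₗ[R] extObj R R M (n + 1) where
  toFun := cocycleExt P n
  map_add' f g := cocycleExt_add P n f g
  map_smul' r f := (cocycleExt_smul P n r f).trans (extObj_smul M (n + 1) r _).symm

theorem cocycleClass_surjective (P : FGResolution M) (n : ℕ) :
    Function.Surjective (cocycleClass P n) := fun e => by
  obtain ⟨f, hf, rfl⟩ := P.extMk_surjective e (n + 2) rfl
  exact ⟨⟨f.hom, congrArg ModuleCat.Hom.hom hf⟩, rfl⟩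

/-- The class of a cocycle in the kernel of `Tr Ω^n M ⟶ P (n + 2) ^*`, as a linear map. -/
noncomputable def cocycleToKer (P : FGResolution M) (n : ℕ) :
    LinearMap.ker (dualMap R R (P.diff (n + 1))).hom →ₗ[R]
      LinearMap.ker (trSyzygyToDual P n).hom :=
  ((trSyzygyπ P n).hom ∘ₗ Submodule.subtype _).codRestrict _ fun f => by
    have h := ConcreteCategory.congr_hom (trSyzygyπ_toDual P n) f.1
    exact h.trans f.2

theorem exact_dualMap_trSyzygyπ (P : FGResolution M) (n : ℕ) :
    Function.Exact (dualMap R R (P.diff n)).hom (trSyzygyπ P n).hom :=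
  (ShortComplex.ShortExact.moduleCat_exact_iff_function_exact _).mp
    (ShortComplex.exact_of_g_is_cokernel
      (ShortComplex.mk (dualMap R R (P.diff n)) (trSyzygyπ P n) (Limits.cokernel.condition _))
      (Limits.cokernelIsCokernel _))

theorem cocycleToKer_surjective (P : FGResolution M) (n : ℕ) :
    Function.Surjective (cocycleToKer P n) := fun t => by
  obtain ⟨f, hf⟩ := (ModuleCat.epi_iff_surjective (trSyzygyπ P n)).mp inferInstance t.1
  have h := ConcreteCategory.congr_hom (trSyzygyπ_toDual P n) f
  refine ⟨⟨f, ?_⟩, Subtype.ext hf⟩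
  refine h.symm.trans ?_
  refine (congrArg (trSyzygyToDual P n).hom hf).trans t.2

/-- Both kernels consist of the coboundaries, that is, the image of the dual of `P.diff n`. -/
theorem ker_cocycleClass (P : FGResolution M) (n : ℕ) :
    LinearMap.ker (cocycleClass P n) = LinearMap.ker (cocycleToKer P n) := by
  ext f
  have h1 : f ∈ LinearMap.ker (cocycleClass P n) ↔
      ∃ g : P.obj n ⟶ ModuleCat.of Rᵐᵒᵖ R, P.complex.d (n + 1) n ≫ g =
        ModuleCat.ofHom (f.1 : P.obj (n + 1) →ₗ[Rᵐᵒᵖ] R) :=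
    P.extMk_eq_zero_iff (ModuleCat.ofHom (f.1 : P.obj (n + 1) →ₗ[Rᵐᵒᵖ] R)) (n + 2) rfl
      (ModuleCat.hom_ext f.2) n rfl
  have h2 : f ∈ LinearMap.ker (cocycleToKer P n) ↔ trSyzygyπ P n f.1 = 0 :=
    Subtype.ext_iff
  rw [h1, h2]
  refine Iff.trans ?_ (exact_dualMap_trSyzygyπ P n f.1).symm
  constructor
  · rintro ⟨g, hg⟩
    exact ⟨g.hom, congrArg ModuleCat.Hom.hom hg⟩
  · rintro ⟨g, hg⟩
    exact ⟨ModuleCat.ofHom g, ModuleCat.hom_ext hg⟩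

/-- `Ext^(n + 1)(M, R)` is the kernel of `Tr Ω^n M ⟶ P (n + 2) ^*`. -/
noncomputable def extObjIso (P : FGResolution M) (n : ℕ) :
    extObj R R M (n + 1) ≅ Limits.kernel (trSyzygyToDual P n) :=
  ((((cocycleClass P n).quotKerEquivOfSurjective (cocycleClass_surjective P n)).symm.trans
    (Submodule.quotEquivOfEq _ _ (ker_cocycleClass P n))).trans
    ((cocycleToKer P n).quotKerEquivOfSurjective (cocycleToKer_surjective P n))).toModuleIso ≪≫
    (ModuleCat.kernelIsoKer (trSyzygyToDual P n)).symm

theorem exact_diff_hom {A : Type u} [Ring A] {X : ModuleCat.{u} A} (P : FGResolution X) (n : ℕ) :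
    Function.Exact (P.diff (n + 1)).hom (P.diff n).hom :=
  (ShortComplex.ShortExact.moduleCat_exact_iff_function_exact _).mp (P.exact_diff n)

/-- Every linear form on `Tr Ω^n M` extends along `Tr Ω^n M ⟶ P (n + 2) ^*`. -/
theorem exists_extension (P : FGResolution M) (n : ℕ) (g : trSyzygy R R P n ⟶ ModuleCat.of R R) :
    ∃ y : dual Rᵐᵒᵖ R R (P.obj (n + 2)) ⟶ ModuleCat.of R R, trSyzygyToDual P n ≫ y = g := by
  have hfin := P.finite
  have hproj : ∀ i, Module.Projective Rᵐᵒᵖ (P.obj i) := fun i =>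
    (IsProjective.iff_projective (P.obj i)).mpr (P.projective i)
  have := hfin n
  have := hfin (n + 1)
  -- By reflexivity the form on `P (n + 1)^*` is evaluation at some `x`. It vanishes on the image of
  -- `P n^*`, so `x` is a cycle, and exactness of `P` writes it as the image of some `y` in `P (n +
  -- 2)`. Evaluation at `y` is the extension.
  obtain ⟨x, hx⟩ := (bidualMap_bijective (P.obj (n + 1))).2 (trSyzygyπ P n ≫ g).hom
  have hx' : ∀ φ : P.obj (n + 1) →ₗ[Rᵐᵒᵖ] R, φ x = g (trSyzygyπ P n φ) :=
    fun φ => LinearMap.congr_fun hx φ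
  have h0 : P.diff n x = 0 := by
    refine (bidualMap_bijective (P.obj n)).1 (LinearMap.ext fun φ => ?_)
    change φ ((P.diff n).hom x) = φ 0
    have h1 : trSyzygyπ P n (dualMap R R (P.diff n) φ) = 0 :=
      (exact_dualMap_trSyzygyπ P n).apply_apply_eq_zero φ
    have h2 := hx' (dualMap R R (P.diff n) φ)
    rw [h1, map_zero] at h2
    rw [map_zero]
    exact h2
  obtain ⟨y, rfl⟩ := (exact_diff_hom P n x).mp h0
  refine ⟨ModuleCat.ofHom (bidualMap (P.obj (n + 2)) y), ?_⟩
  rw [← cancel_epi (trSyzygyπ P n), reassoc_of% trSyzygyπ_toDual]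
  ext φ
  exact hx' φ

/-- The map `Tr Ω^n M ⟶ Im` onto the image of `Tr Ω^n M ⟶ P (n + 2) ^*`. -/
noncomputable abbrev toImage (P : FGResolution M) (n : ℕ) :
    trSyzygy R R P n ⟶ Abelian.image (trSyzygyToDual P n) :=
  Abelian.factorThruImage (trSyzygyToDual P n)

/-- Degree `0` of the surjectivity in the grade criterion holds for every module: extend the form to
`P (n + 2)^*`, then restrict it to the image. -/
theorem extPre_toImage_surjective (P : FGResolution M) (n : ℕ) :
    Function.Surjective (extPre (ModuleCat.of R R) (toImage P n) 0) := fun e => by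
  obtain ⟨g, rfl⟩ := (Ext.mk₀_bijective _ _).2 e
  obtain ⟨y, rfl⟩ := exists_extension P n g
  refine ⟨Ext.mk₀ (Abelian.image.ι (trSyzygyToDual P n) ≫ y), ?_⟩
  rw [extPre, Ext.mk₀_comp_mk₀, reassoc_of% Abelian.image.fac (trSyzygyToDual P n)]

/-- A class in `Ext^1` comes from a form on the image in `P (n + 2)^*`. Such a form extends to `P (n
+ 2)^*`, so its class is zero. -/
theorem subsingleton_ext_one (P : FGResolution M) (n : ℕ) :
    Subsingleton (Ext (trSyzygy R R P (n + 1)) (ModuleCat.of R R) 1) := by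
  refine subsingleton_of_forall_eq 0 fun e => ?_
  obtain ⟨x, rfl⟩ := Ext.contravariant_sequence_exact₃ (imageSeq_shortExact P n) _ e
    (Ext.eq_zero_of_projective _) (add_zero 1)
  obtain ⟨g, rfl⟩ := (Ext.mk₀_bijective _ _).2 x
  obtain ⟨y, hy⟩ := exists_extension P n (toImage P n ≫ g)
  have hg : g = Abelian.image.ι (trSyzygyToDual P n) ≫ y := by
    rw [← cancel_epi (toImage P n), ← hy, reassoc_of% Abelian.image.fac (trSyzygyToDual P n)]
  rw [hg, ← Ext.mk₀_comp_mk₀]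
  exact (imageSeq_shortExact P n).extClass_comp_assoc _

theorem subsingleton_ext_image_iff (P : FGResolution M) (n : ℕ) (Y : ModuleCat.{u} R) {m : ℕ}
    (hm : 1 ≤ m) : Subsingleton (Ext (Abelian.image (trSyzygyToDual P n)) Y m) ↔
      Subsingleton (Ext (trSyzygy R R P (n + 1)) Y (m + 1)) :=
  subsingleton_ext_shift Y (imageSeq_shortExact P n) hm

theorem le_moduleGrade_extObj_iff (P : FGResolution M) (n k : ℕ) :
    (k : ℕ∞) ≤ moduleGrade R R (extObj R R M (n + 1)) ↔
      (∀ m, m < k → Function.Surjective (extPre (ModuleCat.of R R) (toImage P n) m)) ∧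
        (∀ m, 1 ≤ m → m ≤ k → Function.Injective (extPre (ModuleCat.of R R) (toImage P n) m)) := by
  rw [le_moduleGrade_iff, ← subsingleton_ext_iff _ (shortExact_kernel_image (trSyzygyToDual P n))]
  exact forall₂_congr fun m _ => subsingleton_ext_congr (extObjIso P n) _ m

/-- The presentation `P (n + 2) ⟶ P (n + 1) ⟶ Ω^(n + 1) M ⟶ 0`. -/
def FGResolution.syzygyPresentation {A : Type u} [Ring A] {X : ModuleCat.{u} A} (P : FGResolution X)
    (n : ℕ) : Presentation (P.syzygy (n + 1)) where
  P₁ := P.obj (n + 2)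
  P₀ := P.obj (n + 1)
  d := P.diff (n + 1)
  ε := ModuleCat.ofHom (P.diff n).hom.rangeRestrict
  w := by
    ext x
    exact Subtype.ext (ConcreteCategory.congr_hom (P.diff_diff n) x)
  exact := (ShortComplex.ShortExact.moduleCat_exact_iff_function_exact _).mpr fun x =>
    Subtype.ext_iff.trans (exact_diff_hom P n x)
  epi := (ModuleCat.epi_iff_surjective _).mpr (LinearMap.surjective_rangeRestrict _)
  projective₁ := P.projective _
  projective₀ := P.projective _
  finite₁ := P.finite _

/-- The resolution `P` already presents the syzygy, and positive Ext of the transpose does not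
depend on the presentation. Noetherianness supplies a resolution of the syzygy, so the left side is
not vacuous. -/
theorem isTorsionfree_syzygy_iff [IsNoetherianRing Rᵐᵒᵖ] (P : FGResolution M) (n k : ℕ) :
    IsTorsionfree R R k (P.syzygy (n + 1)) ↔
      ∀ m, 1 ≤ m → m ≤ k →
        Subsingleton (Ext (trSyzygy R R P (n + 1)) (ModuleCat.of R R) m) := by
  have := P.finite (n + 1)
  have : Module.Finite Rᵐᵒᵖ (P.syzygy (n + 1)) :=
    Module.Finite.of_surjective _ (LinearMap.surjective_rangeRestrict (P.diff n).hom)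
  obtain ⟨S⟩ := FGResolution.nonempty (P.syzygy (n + 1))
  have key : ∀ (S : FGResolution (P.syzygy (n + 1))) (m : ℕ), 1 ≤ m →
      (Subsingleton (Ext (transpose R R S) (ModuleCat.of R R) m) ↔
        Subsingleton (Ext (trSyzygy R R P (n + 1)) (ModuleCat.of R R) m)) := fun S m hm =>
    subsingleton_ext_transpose_iff R R (P.syzygyPresentation n) S _ hm
  exact ⟨fun h m h1 h2 => (key S m h1).mp (h S m h1 h2),
    fun h S m h1 h2 => (key S m h1).mpr (h m h1 h2)⟩

end ExtKernel

/-! ### Cancellation for the Ext condition. -/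

section Comparison

universe w v v'

variable {C : Type v'} [Category.{v} C] [Abelian C] [HasExt.{w} C]

/-- On Ext, `h` induces the map of `g` followed by that of `f`. The latter is bijective below degree
`j + s` and injective there, exactly what is needed to cancel it on the left. -/
theorem ExtCondition.comp_iff {X X' X'' : C} (Y : C) {f : X ⟶ X'} {g : X' ⟶ X''} {h : X ⟶ X''}
    (hfg : StablyEq h (f ≫ g)) {s j : ℕ} (hf : ExtCondition Y f s j) :
    ExtCondition Y h s j ↔ ExtCondition Y g s j := by
  refine forall₂_congr fun _ hk => ?_
  rw [hfg.extPre_eq Y (by omega), extPre_comp]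
  exact and_congr
    (forall_congr' fun hkj => Function.Bijective.of_comp_iff' ((hf _ hk).1 hkj) _)
    (forall_congr' fun hkj => ((hf _ hk).2 hkj).of_comp_iff _)

theorem extCondition_of_isIso {X X' : C} (Y : C) (f : X ⟶ X') [IsIso f] (s j : ℕ) :
    ExtCondition Y f s j := fun _ _ =>
  ⟨fun _ => extPre_bijective_of_isIso Y f _, fun _ => (extPre_bijective_of_isIso Y f _).1⟩

end Comparison

/-! ### The two inductions and the theorem. -/

section Main

variable {R : Type u} [Ring R] {M : ModuleCat.{u} Rᵐᵒᵖ} (P : FGResolution M)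

/-- Degrees `m > i` of the grade criterion are the Ext condition. Degrees `1 ≤ m ≤ i` match
torsionfreeness: there the target `Ext^m(T i, R)` vanishes by the condition for the preceding
syzygy, and the source is `Ext^(m+1)(T (i + 1), R)`. -/
theorem grade_iff_torsionfree_and_extCondition (n j : ℕ) :
    (∀ i < n, ((i + j : ℕ) : ℕ∞) ≤ moduleGrade R R (extObj R R M (i + 1))) ↔
      ∀ i < n, (∀ m, 1 ≤ m → m ≤ i + 1 →
          Subsingleton (Ext (trSyzygy R R P (i + 1)) (ModuleCat.of R R) m)) ∧
        ExtCondition (ModuleCat.of R R) (toImage P i) i j := by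
  simp only [le_moduleGrade_extObj_iff P]
  constructor
  · intro h
    have htf : ∀ i ≤ n, ∀ m, 1 ≤ m → m ≤ i →
        Subsingleton (Ext (trSyzygy R R P i) (ModuleCat.of R R) m) := by
      intro i
      induction i with
      | zero =>
        intro _ m h1 h2
        omega
      | succ i ih =>
        intro hi m h1 h2
        obtain ⟨m, rfl⟩ := Nat.exists_eq_add_of_le' h1
        rcases Nat.eq_zero_or_pos m with rfl | hm
        · exact subsingleton_ext_one P i
        · rw [← subsingleton_ext_image_iff P i _ hm]
          have := ih (by omega) m hm (by omega)
          -- `Ext^m` of the image embeds in `Ext^m(T i, R)`, which is zero by induction because `m ≤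
          -- i`.
          exact ((h i (by omega)).2 m hm (by omega)).subsingleton
    refine fun i hi => ⟨htf (i + 1) hi, fun k _ => ⟨fun _ => ⟨?_, ?_⟩, fun _ => ?_⟩⟩
    · exact (h i hi).2 _ (by omega) (by omega)
    · exact (h i hi).1 _ (by omega)
    · exact (h i hi).2 _ (by omega) (by omega)
  · intro h i hi
    refine ⟨fun m hm => ?_, fun m h1 hm => ?_⟩
    · rcases Nat.eq_zero_or_pos m with rfl | hm0
      · exact extPre_toImage_surjective P i
      rcases Nat.lt_or_ge i m with him | him
      · obtain ⟨k, rfl⟩ := Nat.exists_eq_add_of_le' him.le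
        exact (((h i hi).2 k (by omega)).1 (by omega)).2
      -- For `0 < m ≤ i` the target vanishes by torsionfreeness at the previous index, which exists
      -- because `i ≥ 1`.
      · obtain ⟨i, rfl⟩ := Nat.exists_eq_add_of_le' (hm0.trans_le him)
        have := (h i (by omega)).1 m hm0 him
        exact fun x => ⟨0, Subsingleton.elim _ _⟩
    · rcases Nat.lt_or_ge i m with him | him
      · obtain ⟨k, rfl⟩ := Nat.exists_eq_add_of_le' him.le
        rcases Nat.lt_or_ge k j with hkj | hkj
        · exact (((h i hi).2 k (by omega)).1 hkj).1
        · exact ((h i hi).2 k (by omega)).2 (by omega)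
      · have := (subsingleton_ext_image_iff P i (ModuleCat.of R R) h1).mpr
          ((h i hi).1 (m + 1) (by omega) (by omega))
        exact Function.injective_of_subsingleton _

/-- The equivalence holds only for all `i < n` together: cancelling the `alpha` of index `i`
requires that it already satisfies the condition, which is known by induction. -/
theorem extCondition_alpha_iff_beta (Q : ∀ i : ℕ, TrResolution P i) (F : ∀ i : ℕ, PsiLift P i (Q i))
    (G : ∀ i : ℕ, PsiStepLift P i (Q i) (Q (i + 1))) (Y : ModuleCat.{u} R) (n j : ℕ) :
    (∀ i < n, ExtCondition Y (F (i + 1)).alpha 0 j) ↔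
      ∀ i < n, ExtCondition Y ((G i).beta i) 0 j := by
  have h0 : ExtCondition Y (F 0).alpha 0 j :=
    have := (F 0).isIso_alpha
    extCondition_of_isIso Y _ 0 j
  have hs : ∀ i, ExtCondition Y (F i).alpha 0 j →
      (ExtCondition Y (F (i + 1)).alpha 0 j ↔ ExtCondition Y ((G i).beta i) 0 j) := fun i hi =>
    hi.comp_iff Y ((F i).stablyEq_alpha_comp_beta (F (i + 1)) (G i))
  induction n with
  | zero => simp
  | succ n ih =>
    simp only [Nat.forall_lt_succ_right, ← ih]
    refine and_congr_right fun h => hs n ?_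
    cases n with
    | zero => exact h0
    | succ n => exact h n (by omega)

end Main

end StableModule

theorem mainTheorem3 {R : Type u} [Ring R] [IsNoetherianRing R] [IsNoetherianRing Rᵐᵒᵖ]
    (n j : ℕ) (hn : 1 ≤ n) (M : ModuleCat.{u} Rᵐᵒᵖ) [Module.Finite Rᵐᵒᵖ M]
    (P : FGResolution M) (Q : ∀ i : ℕ, TrResolution P i)
    (F : ∀ i : ℕ, PsiLift P i (Q i))
    (G : ∀ i : ℕ, PsiStepLift P i (Q i) (Q (i + 1))) :
    List.TFAE
      [∀ i : ℕ, 1 ≤ i → i ≤ n → ((i + j - 1 : ℕ) : ℕ∞) ≤ moduleGrade R R (extObj R R M i),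
       ∀ i : ℕ, 1 ≤ i → i ≤ n →
         IsTorsionfree R R i (P.syzygy i) ∧ ConditionT R R j (psi P i (Q i) (F i)),
       ∀ i : ℕ, i + 1 ≤ n →
         IsTorsionfree R R (i + 1) (P.syzygy (i + 1)) ∧
           ConditionT R R j (psiStep P i (Q i) (Q (i + 1)) (G i))] := by
  have shift : ∀ {p : ℕ → Prop},
      (∀ i, 1 ≤ i → i ≤ n → p i) ↔ ∀ i, i < n → p (i + 1) := fun {p} =>
    ⟨fun h i hi => h (i + 1) (by omega) hi, fun h i h1 hi => by
      obtain ⟨i, rfl⟩ := Nat.exists_eq_add_of_le' h1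
      exact h i hi⟩
  have h13 : (∀ i : ℕ, 1 ≤ i → i ≤ n →
      ((i + j - 1 : ℕ) : ℕ∞) ≤ moduleGrade R R (extObj R R M i)) ↔
      ∀ i : ℕ, i + 1 ≤ n → IsTorsionfree R R (i + 1) (P.syzygy (i + 1)) ∧
        ConditionT R R j (psiStep P i (Q i) (Q (i + 1)) (G i)) := by
    simp only [shift, isTorsionfree_syzygy_iff, conditionT_psiStep_iff,
      PsiStepLift.extCondition_beta, show ∀ i, i + 1 + j - 1 = i + j by omega]
    exact grade_iff_torsionfree_and_extCondition P n j
  have h23 : (∀ i : ℕ, 1 ≤ i → i ≤ n →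
      IsTorsionfree R R i (P.syzygy i) ∧ ConditionT R R j (psi P i (Q i) (F i))) ↔
      ∀ i : ℕ, i + 1 ≤ n → IsTorsionfree R R (i + 1) (P.syzygy (i + 1)) ∧
        ConditionT R R j (psiStep P i (Q i) (Q (i + 1)) (G i)) := by
    rw [shift]
    simp only [conditionT_psi_iff, conditionT_psiStep_iff, Nat.succ_le_iff, forall_and]
    -- The torsionfreeness statements in 2 and 3 coincide, so only the conditions on the natural
    -- maps remain to be compared.
    exact and_congr_right fun _ => extCondition_alpha_iff_beta P Q F G _ n j
  tfae_have 1 ↔ 3 := h13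
  tfae_have 2 ↔ 3 := h23
  tfae_finish
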